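/- A vertex cover of a finite graph is a set of vertices containing at least one end of each edge; it is called minimal if its cardinality is the smallest possible. In a tree $A$, a vertex is called brown if it belongs to every minimal vertex cover, green if it belongs to no minimal vertex cover, and degenerate otherwise; an edge between two degenerate vertices is called red if no minimal vertex cover contains both its ends, and a vertex is called red if it is an end of a red edge. For a color $c\in\{B,R,G\}$ (brown, red, green) and $n\ge 1$ let $N_c(n)$ be the total number of vertices of color $c$ among all $n^{n-2}$ labeled trees on $n$ vertices, and put, as formal power series, $$F_c(x)=\sum_{n\ge1}\frac{N_c(n)}{n!}x^n,\qquad T(x)=\sum_{n\ge1}\frac{n^{n-1}}{n!}x^n .$$ (1) The generating functions are $$F_B(x)=T(x)+T(-T(x))-T(-T(x))^2,\qquad F_R(x)=T(-T(x))^2,\qquad F_G(x)=-T(-T(x)).$$ (2) The first terms, for $n=1,\dots,10$, are $N_B=(0,0,3,4,185,1026,30457,362664,10245825,195060070)$, $N_R=(0,2,0,48,120,4560,35700,1048992,15514128,456726240)$, $N_G=(1,0,6,12,320,2190,51492,685496,17286768,348213690)$. (3) For every $n\ge1$, $$\frac{N_B(n)}{n^{n-1}}=1+\sum_{l=1}^n\Bigl(\frac{-l}{n}\Bigr)^l\Bigl(\frac2l-1\Bigr)\binom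 nl,$$ $$\frac{N_R(n)}{n^{n-1}}=-2\sum_{l=1}^n\Bigl(\frac{-l}{n}\Bigr)^l\Bigl(\frac1l-1\Bigr)\binom nl,$$ $$\frac{N_G(n)}{n^{n-1}}=-\sum_{l=1}^n\Bigl(\frac{-l}{n}\Bigr)^l\binom nl .$$ (4) The sum of the series $T$ on $(-1/e,1/e)$ extends to a real-analytic function on $(-\infty,1/e)$, again denoted by $T$, and as $n\to\infty$ $$\frac{N_B(n)}{n^{n-1}}\to 1+T'(-1)+2T(-1)=0.2276096758\ldots,$$ $$\frac{N_R(n)}{n^{n-1}}\to -2\bigl(T'(-1)+T(-1)\bigr)=0.4104940675\ldots,$$ $$\frac{N_G(n)}{n^{n-1}}\to T'(-1)=0.3618962566\ldots,$$ where the printed decimals are the truncated decimal expansions of the limits. -/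

import Mathlib

namespace TreeColoring

variable {V : Type*}

/-- A minimal vertex cover: a vertex cover of smallest cardinality among all vertex covers. -/
def IsMinVertexCover (A : SimpleGraph V) (C : Finset V) : Prop :=
  A.IsVertexCover (C : Set V) ∧ ∀ D : Finset V, A.IsVertexCover (D : Set V) → C.card ≤ D.card

/-- The vertices that belong to every minimal vertex cover. -/
def positiveBackbone (A : SimpleGraph V) : Set V :=
  {v | ∀ C : Finset V, IsMinVertexCover A C → v ∈ C}

/-- The vertices that belong to no minimal vertex cover. -/
def negativeBackbone (A : SimpleGraph V) : Set V :=
  {v | ∀ C : Finset V, IsMinVertexCover A C → v ∉ C}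

/-- The degenerate vertices: those in neither backbone. -/
def degenerateVertices (A : SimpleGraph V) : Set V :=
  {v | v ∉ positiveBackbone A ∧ v ∉ negativeBackbone A}

/-- `{v, w}` is an exclusive edge: an edge between degenerate vertices such that no minimal
vertex cover contains both its ends. -/
def IsExclusiveEdge (A : SimpleGraph V) (v w : V) : Prop :=
  A.Adj v w ∧ v ∈ degenerateVertices A ∧ w ∈ degenerateVertices A ∧
    ∀ C : Finset V, IsMinVertexCover A C → ¬ (v ∈ C ∧ w ∈ C)

/-- The three colors of vertices. -/
inductive Color
  | brown
  | red
  | green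

/-- The set of vertices of a given color: the brown vertices form the positive backbone, the red
vertices are the ends of the exclusive (that is, red) edges, and the green vertices form the
negative backbone. -/
def colorClass (A : SimpleGraph V) : Color → Set V
  | .brown => positiveBackbone A
  | .red => {v | ∃ w, IsExclusiveEdge A v w}
  | .green => negativeBackbone A

open Classical in
/-- The total number of vertices of color `c` among all labeled trees with vertex set `Fin n`. -/
noncomputable def totalColored (c : Color) (n : ℕ) : ℕ :=
  ∑ A : {A : SimpleGraph (Fin n) // A.IsTree}, (colorClass A.1 c).ncard

/-- The exponential generating function `∑_{n ≥ 1} (a n / n!) x ^ n`, as a formal power series. -/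
noncomputable def egf (a : ℕ → ℕ) : PowerSeries ℚ :=
  PowerSeries.mk fun n => if n = 0 then 0 else (a n : ℚ) / (n.factorial : ℚ)

/-- The tree generating function `T(x) = ∑_{n ≥ 1} (n ^ (n - 1) / n!) x ^ n`. -/
noncomputable def treeSeries : PowerSeries ℚ := egf fun n => n ^ (n - 1)

/-- The generating function `F_c(x) = ∑_{n ≥ 1} (N_c(n) / n!) x ^ n`. -/
noncomputable def colorSeries (c : Color) : PowerSeries ℚ := egf (totalColored c)

/-- The formal power series `T(-T(x))`. -/
noncomputable def treeSeriesNegTree : PowerSeries ℚ := treeSeries.subst (-treeSeries)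

/-- `f` is the real-analytic continuation of `T` to `(-∞, 1/e)`: it is analytic there and is the
sum of the series on `(-1/e, 1/e)`. -/
def IsTreeContinuation (f : ℝ → ℝ) : Prop :=
  AnalyticOnNhd ℝ f (Set.Iio (Real.exp (-1))) ∧
    ∀ x : ℝ, |x| < Real.exp (-1) →
      HasSum (fun n : ℕ => ((PowerSeries.coeff n treeSeries : ℚ) : ℝ) * x ^ n) (f x)

end TreeColoring

/-! An edge `{v, w}` of a tree cuts it into two subtrees, its halves. Unless both ends are green in
their halves, minimal covers of the tree restrict to minimal covers of the halves; if both are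
green, the edge costs exactly one extra vertex. Hence `v` is green iff it is green in its half and
`w` is not green in its own (`IsSplit.mem_negativeBackbone_iff`), and the edge is red iff both ends
are green in their halves (`IsSplit.isExclusiveEdge_iff`). Red edges form a perfect matching of the
degenerate vertices, so the three colors partition the vertices.

Marking a vertex other than the root selects an edge at the root, and double counting gives, with ϑ
= x d/dx and F the green series, ϑT = T + TϑT and ϑF = F + Fϑ(T - F). The first equation yields
Cayley's formula; the second determines F from its linear coefficient, and -T(-T) satisfies it. The
matching gives F² for red, and brown is the rest. The closed formulas follow from the coefficients
of the powers of T, which the first equation also provides.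

For the asymptotics let t_n be the coefficients of T scaled by e^(-n), p_n the green proportion and
g_n = p_n t_n. Here n t_n is asymptotically shift-invariant and Σ t_n = T(1/e) = 1. With Ω = Σ g_n,
the integrated equation F = x exp(T - F) at 1/e gives Ω = e^(-Ω). Dividing the green recurrence by n
t_n makes p_n, up to a null sequence, an average of 1 - p_(n-k) with weights tending to g_k. As Ω <
1 this is a contraction, so p_n tends to the solution Ω/(1+Ω) of p = Ω(1 - p). The red limit is 2Ω
times this one, because ϑ(F²) = 2FϑF. Finally T continues as the inverse of y e^(-y), whence T(-1) =
-Ω and T'(-1) = Ω/(1+Ω). -/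

namespace TreeColoring

open SimpleGraph

/-! ### Cutting a tree at an edge -/

section Split

variable {V : Type*}

/-- `{v, w}` is the only edge of `A` between `S` and its complement, and it splits `A` into a tree
on `S` and a tree on the complement. -/
structure IsSplit (A : SimpleGraph V) (S : Set V) (v w : V) : Prop where
  left_mem : v ∈ S
  right_mem : w ∈ Sᶜ
  left_tree : (A.induce S).IsTree
  right_tree : (A.induce Sᶜ).IsTree
  adj_iff : ∀ x ∈ S, ∀ y ∈ Sᶜ, A.Adj x y ↔ x = v ∧ y = w

variable {A : SimpleGraph V} {S S' : Set V} {v w w' x y : V}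

theorem mem_of_preconnected (hA : A.Preconnected) {Z : Set V} (hx : x ∈ Z)
    (hZ : ∀ a ∈ Z, ∀ b, A.Adj a b → b ∈ Z) (y : V) : y ∈ Z := by
  obtain ⟨p⟩ := hA x y
  induction p with
  | nil => exact hx
  | cons h p ih => exact ih (hZ _ hx _ h)

theorem IsSplit.adj (h : IsSplit A S v w) : A.Adj v w :=
  (h.adj_iff v h.left_mem w h.right_mem).2 ⟨rfl, rfl⟩

theorem IsSplit.symm (h : IsSplit A S v w) : IsSplit A Sᶜ w v where
  left_mem := h.right_mem
  right_mem := by simpa using h.left_mem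
  left_tree := h.right_tree
  right_tree := by rw [compl_compl]; exact h.left_tree
  adj_iff x hx y hy := by
    rw [A.adj_comm, h.adj_iff y (by simpa using hy) x hx, and_comm]

theorem reachable_of_induce {G : SimpleGraph V} (hG : ∀ a ∈ S, ∀ b ∈ S, A.Adj a b → G.Adj a b)
    (hS : (A.induce S).Preconnected) (hx : x ∈ S) (hy : y ∈ S) : G.Reachable x y := by
  have := (hS ⟨x, hx⟩ ⟨y, hy⟩).map (⟨Subtype.val, fun {a b} h => hG a a.2 b b.2 h⟩ : A.induce S →g G)
  exact this

theorem IsSplit.adj_cases (h : IsSplit A S v w) (hxy : A.Adj x y) :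
    (x ∈ S ∧ y ∈ S) ∨ (x ∈ Sᶜ ∧ y ∈ Sᶜ) ∨ (x = v ∧ y = w) ∨ (x = w ∧ y = v) := by
  by_cases hx : x ∈ S <;> by_cases hy : y ∈ S
  · exact .inl ⟨hx, hy⟩
  · exact .inr (.inr (.inl ((h.adj_iff x hx y hy).1 hxy)))
  · exact .inr (.inr (.inr ((h.adj_iff y hy x hx).1 hxy.symm).symm))
  · exact .inr (.inl ⟨hx, hy⟩)

theorem IsSplit.isBridge_of_mem (h : IsSplit A S v w) {a b : V} (ha : a ∈ S) (hb : b ∈ S)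
    (hab : A.Adj a b) : A.IsBridge s(a, b) := by
  set B := (A.induce S).deleteEdges {s(⟨a, ha⟩, ⟨b, hb⟩)} with hB
  have hbr : ¬ B.Reachable ⟨a, ha⟩ ⟨b, hb⟩ :=
    isBridge_iff.1 (isAcyclic_iff_forall_adj_isBridge.1 h.left_tree.2
      (show (A.induce S).Adj ⟨a, ha⟩ ⟨b, hb⟩ from hab))
  rw [isBridge_iff]
  rintro ⟨p⟩
  -- Invariant along the walk: collapse the complement of `S` to `v`. A walk leaves and re-enters
  -- `S` only through `v`, so its collapsed image is a walk inside `S` avoiding the edge.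
  have key : ∀ {x y} (_ : (A.deleteEdges {s(a, b)}).Walk x y),
      ((∃ hx : x ∈ S, B.Reachable ⟨a, ha⟩ ⟨x, hx⟩) ∨
        (x ∉ S ∧ B.Reachable ⟨a, ha⟩ ⟨v, h.left_mem⟩)) →
      ((∃ hx : y ∈ S, B.Reachable ⟨a, ha⟩ ⟨y, hx⟩) ∨
        (y ∉ S ∧ B.Reachable ⟨a, ha⟩ ⟨v, h.left_mem⟩)) := by
    intro x y p
    induction p with
    | nil => exact id
    | @cons x z y hxz p ih =>
      refine fun hx => ih ?_
      rw [deleteEdges_adj] at hxz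
      rcases hx with ⟨hx, hr⟩ | ⟨hx, hr⟩
      · by_cases hz : z ∈ S
        · refine .inl ⟨hz, hr.trans (Adj.reachable ?_)⟩
          rw [hB, deleteEdges_adj]
          refine ⟨hxz.1, fun hs => hxz.2 ?_⟩
          exact congrArg (Sym2.map Subtype.val) hs
        · obtain ⟨rfl, rfl⟩ := (h.adj_iff x hx z hz).1 hxz.1
          exact .inr ⟨hz, hr⟩
      · by_cases hz : z ∈ S
        · obtain ⟨rfl, rfl⟩ := (h.adj_iff z hz x hx).1 hxz.1.symm
          exact .inl ⟨hz, hr⟩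
        · exact .inr ⟨hz, hr⟩
  rcases key p (.inl ⟨ha, Reachable.refl _⟩) with ⟨_, h1⟩ | ⟨h1, _⟩
  · exact hbr h1
  · exact h1 hb

/-- The side `S` is the component of `v` once the edge is removed; hence the edge determines it. -/
theorem IsSplit.mem_iff (h : IsSplit A S v w) :
    x ∈ S ↔ (A.deleteEdges {s(v, w)}).Reachable v x := by
  constructor
  · intro hx
    refine reachable_of_induce (fun a ha b hb hab => ?_) h.left_tree.1.preconnected h.left_mem hx
    rw [deleteEdges_adj]
    refine ⟨hab, fun hs => ?_⟩
    rcases Sym2.eq_iff.1 hs with ⟨rfl, rfl⟩ | ⟨rfl, rfl⟩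
    · exact h.right_mem hb
    · exact h.right_mem ha
  · rintro ⟨p⟩
    have key : ∀ {a b} (_ : (A.deleteEdges {s(v, w)}).Walk a b), a ∈ S → b ∈ S := by
      intro a b p
      induction p with
      | nil => exact id
      | cons hab p ih =>
        intro ha
        refine ih ?_
        by_contra hb
        rw [deleteEdges_adj] at hab
        obtain ⟨rfl, rfl⟩ := (h.adj_iff _ ha _ hb).1 hab.1
        exact hab.2 rfl
    exact key p h.left_mem

theorem IsSplit.isBridge (h : IsSplit A S v w) : A.IsBridge s(v, w) := by
  rw [isBridge_iff, ← h.mem_iff]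
  exact h.right_mem

theorem IsSplit.isTree (h : IsSplit A S v w) : A.IsTree := by
  have : Nonempty V := ⟨v⟩
  have hvw := h.adj
  have reach : ∀ x, A.Reachable v x := fun x => by
    by_cases hx : x ∈ S
    · exact reachable_of_induce (fun _ _ _ _ h => h) h.left_tree.1.preconnected h.left_mem hx
    · exact hvw.reachable.trans
        (reachable_of_induce (fun _ _ _ _ h => h) h.right_tree.1.preconnected h.right_mem hx)
  refine ⟨⟨fun x y => (reach x).symm.trans (reach y)⟩, isAcyclic_iff_forall_adj_isBridge.2 ?_⟩
  intro x y hxy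
  rcases h.adj_cases hxy with ⟨hx, hy⟩ | ⟨hx, hy⟩ | ⟨rfl, rfl⟩ | ⟨rfl, rfl⟩
  · exact h.isBridge_of_mem hx hy hxy
  · exact h.symm.isBridge_of_mem hx hy hxy
  · exact h.isBridge
  · exact h.symm.isBridge

theorem IsSplit.unique (h : IsSplit A S v w) (h' : IsSplit A S' v w) : S = S' := by
  ext x
  rw [h.mem_iff, h'.mem_iff]

theorem exists_isSplit (hA : A.IsTree) (hvw : A.Adj v w) : ∃ S, IsSplit A S v w := by
  set B := A.deleteEdges {s(v, w)} with hB
  have hbr : ¬ B.Reachable v w := by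
    have := (isAcyclic_iff_forall_adj_isBridge.1 hA.2) hvw
    exact isBridge_iff.1 this
  have hadj : ∀ {x y}, A.Adj x y → B.Adj x y ∨ (x = v ∧ y = w) ∨ (x = w ∧ y = v) := by
    intro x y h
    by_cases hs : s(x, y) = s(v, w)
    · exact .inr (Sym2.eq_iff.1 hs)
    · exact .inl ((deleteEdges_adj).2 ⟨h, hs⟩)
  have hBA : ∀ {x y}, B.Adj x y → A.Adj x y := fun h => (deleteEdges_adj.1 h).1
  have hcompl : {x | B.Reachable v x}ᶜ = {x | B.Reachable w x} := by
    ext x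
    simp only [Set.mem_compl_iff, Set.mem_ofPred_eq]
    refine ⟨?_, fun hx hx' => hbr (hx'.trans hx.symm)⟩
    have := mem_of_preconnected hA.1.preconnected (Z := {x | B.Reachable v x ∨ B.Reachable w x})
      (.inl (Reachable.refl v)) (fun a ha b hab => ?_) x
    · exact this.resolve_left
    · rcases hadj hab with h | ⟨rfl, rfl⟩ | ⟨rfl, rfl⟩
      · exact ha.imp (·.trans h.reachable) (·.trans h.reachable)
      · exact .inr (Reachable.refl _)
      · exact .inl (Reachable.refl _)
  have htree : ∀ u, (A.induce {x | B.Reachable u x}).IsTree := fun u => by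
    have key : ∀ {a b} (_ : B.Walk a b) (ha : B.Reachable u a) (hb : B.Reachable u b),
        (A.induce {x | B.Reachable u x}).Reachable ⟨a, ha⟩ ⟨b, hb⟩ := by
      intro a b p
      induction p with
      | nil => exact fun _ _ => Reachable.refl _
      | cons hac p ih =>
        intro ha hb
        have hc := ha.trans hac.reachable
        have hadj : (A.induce {x | B.Reachable u x}).Adj ⟨_, ha⟩ ⟨_, hc⟩ := hBA hac
        exact hadj.reachable.trans (ih hc hb)
    have : Nonempty {x | B.Reachable u x} := ⟨⟨u, Reachable.refl u⟩⟩
    refine ⟨⟨fun x y => ?_⟩, hA.2.induce _⟩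
    obtain ⟨p⟩ := x.2.symm.trans y.2
    exact key p x.2 y.2
  refine ⟨{x | B.Reachable v x}, Reachable.refl v, hbr, htree v, hcompl ▸ htree w, ?_⟩
  intro x hx y hy
  refine ⟨fun h => ?_, fun ⟨h1, h2⟩ => h1 ▸ h2 ▸ hvw⟩
  rcases hadj h with h | h | ⟨rfl, rfl⟩
  · exact absurd (hx.trans h.reachable) hy
  · exact h
  · exact absurd hx hbr

/-- The edge in question is the first one on the path from `v` to `x`. This is what turns a marked
vertex into an edge at the root in the double count. -/
theorem existsUnique_isSplit_of_ne (hA : A.IsTree) (hx : x ≠ v) :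
    ∃! p : Set V × V, IsSplit A p.1 v p.2 ∧ x ∉ p.1 := by
  have ex : ∃ p : Set V × V, IsSplit A p.1 v p.2 ∧ x ∉ p.1 := by
    have := mem_of_preconnected hA.1.preconnected (x := v)
      (Z := {x | x = v ∨ ∃ p : Set V × V, IsSplit A p.1 v p.2 ∧ x ∉ p.1})
      (.inl rfl) (fun a ha b hab => ?_) x
    · exact this.resolve_left hx
    · rcases ha with rfl | ⟨⟨S, w⟩, h, ha⟩
      · obtain ⟨S, hS⟩ := exists_isSplit hA hab
        exact .inr ⟨⟨S, b⟩, hS, hS.right_mem⟩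
      · rcases h.adj_cases hab with h1 | h1 | ⟨rfl, rfl⟩ | ⟨rfl, rfl⟩
        · exact absurd h1.1 ha
        · exact .inr ⟨⟨S, w⟩, h, h1.2⟩
        · exact absurd h.left_mem ha
        · exact .inl rfl
  refine existsUnique_of_exists_of_unique ex ?_
  rintro ⟨S, w⟩ ⟨S', w'⟩ ⟨h, hxS⟩ ⟨h', hxS'⟩
  -- If `w ≠ w'`, then `w'` lies in `S`. The far side of the second split is connected, starts at
  -- `w'` and misses `v`, the only exit from `S`; so it stays in `S`, although it contains `x`.
  obtain rfl : w = w' := by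
    by_contra hne
    have hw' : w' ∈ S := by
      by_contra hc
      exact hne ((h.adj_iff v h.left_mem w' hc).1 h'.adj).2.symm
    have := mem_of_preconnected h'.right_tree.1.preconnected (x := ⟨w', h'.right_mem⟩)
      (Z := {z | z.1 ∈ S}) hw' (fun a ha b hab => ?_) ⟨x, hxS'⟩
    · exact hxS this
    · by_contra hb
      have h1 := ((h.adj_iff a ha b hb).1 hab).1
      exact a.2 (h1 ▸ h'.left_mem)
  simp only [Prod.mk.injEq, and_true]
  exact h.unique h'

end Split

end TreeColoring

/-! ### Minimal vertex covers and splits -/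

namespace TreeColoring

open SimpleGraph

section Cover

variable {V : Type*} {A : SimpleGraph V} {S : Set V} {v w w' x y : V} {C D : Finset V}

open Classical in
/-- The part of a finite set of vertices lying in `S`. -/
noncomputable def restrict (S : Set V) (C : Finset V) : Finset S := C.subtype (· ∈ S)

@[simp]
theorem mem_restrict {a : S} : a ∈ restrict S C ↔ (a : V) ∈ C := by
  simp [restrict]

theorem card_restrict_add : (restrict S C).card + (restrict Sᶜ C).card = C.card := by
  classical
  simp only [restrict, Finset.card_subtype, Set.mem_compl_iff]
  convert! Finset.card_filter_add_card_filter_not (s := C) (· ∈ S)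

theorem exists_restrict_eq (C₁ : Finset S) (C₂ : Finset ↥Sᶜ) :
    ∃ C : Finset V, restrict S C = C₁ ∧ restrict Sᶜ C = C₂ := by
  classical
  refine ⟨C₁.map (Function.Embedding.subtype _) ∪ C₂.map (Function.Embedding.subtype _), ?_, ?_⟩
  · ext ⟨a, ha⟩
    have : ∀ h : a ∈ Sᶜ, (⟨a, h⟩ : ↥Sᶜ) ∉ C₂ := fun h => absurd ha h
    simp [ha]
  · ext ⟨a, ha⟩
    have ha' : a ∉ S := ha
    simp [ha']

theorem exists_isMinVertexCover [Finite V] (A : SimpleGraph V) : ∃ C, IsMinVertexCover A C := by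
  have := Fintype.ofFinite V
  have hne : {C : Finset V | A.IsVertexCover (C : Set V)}.Nonempty := ⟨Finset.univ, by simp⟩
  exact ⟨Function.argminOn Finset.card _ hne, Function.argminOn_mem _ _ hne,
    fun D hD => Function.argminOn_le _ _ hD⟩

theorem IsMinVertexCover.of_card_le (hC : IsMinVertexCover A C)
    (hD : A.IsVertexCover (D : Set V)) (h : D.card ≤ C.card) : IsMinVertexCover A D :=
  ⟨hD, fun E hE => h.trans (hC.2 E hE)⟩

theorem card_lt_of_mem_negativeBackbone (hC : IsMinVertexCover A C)
    (hD : A.IsVertexCover (D : Set V)) (hv : v ∈ negativeBackbone A) (hvD : v ∈ D) :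
    C.card < D.card := by
  by_contra h
  exact hv D (hC.of_card_le hD (not_lt.1 h)) hvD

theorem exists_of_notMem_negativeBackbone (hv : v ∉ negativeBackbone A) :
    ∃ C, IsMinVertexCover A C ∧ v ∈ C := by
  simpa [negativeBackbone] using hv

theorem exists_of_notMem_positiveBackbone (hv : v ∉ positiveBackbone A) :
    ∃ C, IsMinVertexCover A C ∧ v ∉ C := by
  simpa [positiveBackbone] using hv

theorem IsSplit.isVertexCover_iff (h : IsSplit A S v w) :
    A.IsVertexCover (C : Set V) ↔ (A.induce S).IsVertexCover (restrict S C : Set S) ∧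
      (A.induce Sᶜ).IsVertexCover (restrict Sᶜ C : Set ↥Sᶜ) ∧ (v ∈ C ∨ w ∈ C) := by
  constructor
  · refine fun hC => ⟨fun a b hab => ?_, fun a b hab => ?_, hC h.adj⟩
    · simpa using hC hab
    · simpa using hC hab
  · rintro ⟨h1, h2, h3⟩ a b hab
    rcases h.adj_cases hab with ⟨ha, hb⟩ | ⟨ha, hb⟩ | ⟨rfl, rfl⟩ | ⟨rfl, rfl⟩
    · simpa using @h1 ⟨a, ha⟩ ⟨b, hb⟩ hab
    · simpa using @h2 ⟨a, ha⟩ ⟨b, hb⟩ hab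
    · exact h3
    · exact h3.symm

variable {C₁ : Finset S} {C₂ : Finset ↥Sᶜ}

theorem IsSplit.isMinVertexCover_of_restrict (h : IsSplit A S v w)
    (h1 : IsMinVertexCover (A.induce S) (restrict S C))
    (h2 : IsMinVertexCover (A.induce Sᶜ) (restrict Sᶜ C)) (h3 : v ∈ C ∨ w ∈ C) :
    IsMinVertexCover A C := by
  refine ⟨h.isVertexCover_iff.2 ⟨h1.1, h2.1, h3⟩, fun D hD => ?_⟩
  obtain ⟨d1, d2, -⟩ := h.isVertexCover_iff.1 hD
  rw [← card_restrict_add (S := S) (C := C), ← card_restrict_add (S := S) (C := D)]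
  exact add_le_add (h1.2 _ d1) (h2.2 _ d2)

/-- If one end is not green in its half, minimal covers of the halves can be chosen so that their
union covers the edge. The optimum is then the sum of the two optima, so both restrictions are
optimal. -/
theorem IsSplit.isMinVertexCover_restrict [Finite V] (h : IsSplit A S v w)
    (hg : ¬ (⟨v, h.left_mem⟩ ∈ negativeBackbone (A.induce S) ∧
      ⟨w, h.right_mem⟩ ∈ negativeBackbone (A.induce Sᶜ)))
    (hC : IsMinVertexCover A C) :
    IsMinVertexCover (A.induce S) (restrict S C) ∧
      IsMinVertexCover (A.induce Sᶜ) (restrict Sᶜ C) := by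
  obtain ⟨C₁, C₂, h1, h2, h3⟩ : ∃ C₁ C₂, IsMinVertexCover (A.induce S) C₁ ∧
      IsMinVertexCover (A.induce Sᶜ) C₂ ∧ (⟨v, h.left_mem⟩ ∈ C₁ ∨ ⟨w, h.right_mem⟩ ∈ C₂) := by
    rcases not_and_or.1 hg with hg | hg
    · obtain ⟨C₁, h1, hv⟩ := exists_of_notMem_negativeBackbone hg
      obtain ⟨C₂, h2⟩ := exists_isMinVertexCover (A.induce Sᶜ)
      exact ⟨C₁, C₂, h1, h2, .inl hv⟩
    · obtain ⟨C₂, h2, hw⟩ := exists_of_notMem_negativeBackbone hg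
      obtain ⟨C₁, h1⟩ := exists_isMinVertexCover (A.induce S)
      exact ⟨C₁, C₂, h1, h2, .inr hw⟩
  obtain ⟨D, rfl, rfl⟩ := exists_restrict_eq C₁ C₂
  obtain ⟨c1, c2, -⟩ := h.isVertexCover_iff.1 hC.1
  have hD := hC.2 D (h.isVertexCover_iff.2 ⟨h1.1, h2.1, by simpa using h3⟩)
  rw [← card_restrict_add (S := S) (C := C), ← card_restrict_add (S := S) (C := D)] at hD
  have e1 := h1.2 _ c1
  have e2 := h2.2 _ c2
  exact ⟨h1.of_card_le c1 (by omega), h2.of_card_le c2 (by omega)⟩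

/-- Covering the edge forces a green end into the cover of its half, which costs at least one vertex
above the two optima. -/
theorem IsSplit.isMinVertexCover_of_card_le (h : IsSplit A S v w)
    (hv : ⟨v, h.left_mem⟩ ∈ negativeBackbone (A.induce S))
    (hw : ⟨w, h.right_mem⟩ ∈ negativeBackbone (A.induce Sᶜ))
    (h1 : IsMinVertexCover (A.induce S) C₁) (h2 : IsMinVertexCover (A.induce Sᶜ) C₂)
    (hC : A.IsVertexCover (C : Set V)) (hle : C.card ≤ C₁.card + C₂.card + 1) :
    IsMinVertexCover A C := by
  refine ⟨hC, fun D hD => hle.trans ?_⟩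
  obtain ⟨d1, d2, h3⟩ := h.isVertexCover_iff.1 hD
  rw [← card_restrict_add (S := S) (C := D)]
  have e1 := h1.2 _ d1
  have e2 := h2.2 _ d2
  rcases h3 with h3 | h3
  · have := card_lt_of_mem_negativeBackbone h1 d1 hv (by simpa using h3)
    omega
  · have := card_lt_of_mem_negativeBackbone h2 d2 hw (by simpa using h3)
    omega

/-- When both ends of the splitting edge are green in their halves, adding one end to a union of
minimal vertex covers of the halves yields a minimal vertex cover. -/
theorem IsSplit.exists_isMinVertexCover_insert (h : IsSplit A S v w)
    (hv : ⟨v, h.left_mem⟩ ∈ negativeBackbone (A.induce S))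
    (hw : ⟨w, h.right_mem⟩ ∈ negativeBackbone (A.induce Sᶜ))
    (h1 : IsMinVertexCover (A.induce S) C₁) (h2 : IsMinVertexCover (A.induce Sᶜ) C₂) :
    ∃ C, IsMinVertexCover A C ∧ v ∈ C ∧ w ∉ C ∧ (∀ a ∈ C₁, (a : V) ∈ C) ∧
      C.card ≤ C₁.card + C₂.card + 1 := by
  classical
  obtain ⟨C, hC1, hC2⟩ := exists_restrict_eq (insert ⟨v, h.left_mem⟩ C₁) C₂
  have hvC : v ∈ C := by
    have : (⟨v, h.left_mem⟩ : S) ∈ restrict S C := by simp [hC1]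
    simpa using this
  have hcov : A.IsVertexCover (C : Set V) := by
    rw [h.isVertexCover_iff, hC1, hC2]
    exact ⟨h1.1.subset (by simp), h2.1, .inl hvC⟩
  have hcard : C.card ≤ C₁.card + C₂.card + 1 := by
    rw [← card_restrict_add (S := S), hC1, hC2]
    have := Finset.card_insert_le ⟨v, h.left_mem⟩ C₁
    omega
  refine ⟨C, h.isMinVertexCover_of_card_le hv hw h1 h2 hcov hcard, hvC, fun hwC => ?_,
    fun a ha => ?_, hcard⟩
  · refine hw C₂ h2 ?_
    rw [← hC2]
    simpa using hwC
  · have : a ∈ restrict S C := by simp [hC1, ha]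
    simpa using this

/-- If `w` can be used at no cost in its half, minimal covers restrict to both halves and a green
`v` stays unused. If both ends are green in their halves, the extra vertex may be `v`. If `v` is not
green in its half, gluing minimal covers gives one that contains it. -/
theorem IsSplit.mem_negativeBackbone_iff [Finite V] (h : IsSplit A S v w) :
    v ∈ negativeBackbone A ↔ ⟨v, h.left_mem⟩ ∈ negativeBackbone (A.induce S) ∧
      ⟨w, h.right_mem⟩ ∉ negativeBackbone (A.induce Sᶜ) := by
  constructor
  · intro hg
    have hv : ⟨v, h.left_mem⟩ ∈ negativeBackbone (A.induce S) := by
      by_contra hv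
      obtain ⟨C₁, h1, hvC⟩ := exists_of_notMem_negativeBackbone hv
      obtain ⟨C₂, h2⟩ := exists_isMinVertexCover (A.induce Sᶜ)
      obtain ⟨C, rfl, rfl⟩ := exists_restrict_eq C₁ C₂
      rw [mem_restrict] at hvC
      exact hg C (h.isMinVertexCover_of_restrict h1 h2 (.inl hvC)) hvC
    refine ⟨hv, fun hw => ?_⟩
    obtain ⟨C₁, h1⟩ := exists_isMinVertexCover (A.induce S)
    obtain ⟨C₂, h2⟩ := exists_isMinVertexCover (A.induce Sᶜ)
    obtain ⟨C, hC, hvC, -⟩ := h.exists_isMinVertexCover_insert hv hw h1 h2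
    exact hg C hC hvC
  · rintro ⟨hv, hw⟩ C hC hvC
    exact hv _ (h.isMinVertexCover_restrict (fun hg => hw hg.2) hC).1 (by simpa using hvC)

theorem IsSplit.isExclusiveEdge_iff [Finite V] (h : IsSplit A S v w) :
    IsExclusiveEdge A v w ↔ ⟨v, h.left_mem⟩ ∈ negativeBackbone (A.induce S) ∧
      ⟨w, h.right_mem⟩ ∈ negativeBackbone (A.induce Sᶜ) := by
  constructor
  · rintro ⟨-, ⟨-, hv⟩, ⟨-, hw⟩, hex⟩
    by_contra hg
    -- If exactly one end is green in its half, it is green in `A`, hence not degenerate. If neither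
    -- is, gluing produces a minimal cover with both ends.
    rcases not_and_or.1 hg with hg' | hg'
    · obtain ⟨C₁, h1, hvC⟩ := exists_of_notMem_negativeBackbone hg'
      by_cases hw' : ⟨w, h.right_mem⟩ ∈ negativeBackbone (A.induce Sᶜ)
      · exact hw fun C hC hwC => hw' _ (h.isMinVertexCover_restrict hg hC).2 (by simpa using hwC)
      · obtain ⟨C₂, h2, hwC⟩ := exists_of_notMem_negativeBackbone hw'
        obtain ⟨C, rfl, rfl⟩ := exists_restrict_eq C₁ C₂
        rw [mem_restrict] at hvC hwC
        exact hex C (h.isMinVertexCover_of_restrict h1 h2 (.inl hvC)) ⟨hvC, hwC⟩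
    · by_cases hv' : ⟨v, h.left_mem⟩ ∈ negativeBackbone (A.induce S)
      · exact hv fun C hC hvC => hv' _ (h.isMinVertexCover_restrict hg hC).1 (by simpa using hvC)
      · obtain ⟨C₁, h1, hvC⟩ := exists_of_notMem_negativeBackbone hv'
        obtain ⟨C₂, h2, hwC⟩ := exists_of_notMem_negativeBackbone hg'
        obtain ⟨C, rfl, rfl⟩ := exists_restrict_eq C₁ C₂
        rw [mem_restrict] at hvC hwC
        exact hex C (h.isMinVertexCover_of_restrict h1 h2 (.inl hvC)) ⟨hvC, hwC⟩
  · rintro ⟨hv, hw⟩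
    obtain ⟨C₁, h1⟩ := exists_isMinVertexCover (A.induce S)
    obtain ⟨C₂, h2⟩ := exists_isMinVertexCover (A.induce Sᶜ)
    obtain ⟨C, hC, hvC, hwC, -, hcard⟩ := h.exists_isMinVertexCover_insert hv hw h1 h2
    -- The reversed split has far side `Sᶜᶜ`, equal to `S` but a different type, so greenness of `v`
    -- has to be transported.
    have hS : ∀ S' : Set V, S' = S → ∀ hv' : v ∈ S',
        (⟨v, hv'⟩ : S') ∈ negativeBackbone (A.induce S') := by
      rintro _ rfl _
      exact hv
    obtain ⟨C₃, h3⟩ := exists_isMinVertexCover (A.induce Sᶜᶜ)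
    obtain ⟨D, hD, hwD, hvD, -⟩ := h.symm.exists_isMinVertexCover_insert hw
      (hS _ (compl_compl S) h.symm.right_mem) h2 h3
    refine ⟨h.adj, ⟨fun hp => hvD (hp D hD), fun hn => hn C hC hvC⟩,
      ⟨fun hp => hwC (hp C hC), fun hn => hn D hD hwD⟩, fun E hE hvw => ?_⟩
    obtain ⟨e1, e2, -⟩ := h.isVertexCover_iff.1 hE.1
    -- A cover with both ends exceeds the optimum of each half, hence the sum of the optima by two,
    -- where one suffices.
    have l1 := card_lt_of_mem_negativeBackbone h1 e1 hv (by simpa using hvw.1)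
    have l2 := card_lt_of_mem_negativeBackbone h2 e2 hw (by simpa using hvw.2)
    have l3 := hE.2 C hC.1
    rw [← card_restrict_add (S := S) (C := E)] at l3
    omega

/-- Add `v` to minimal covers of the halves cut by the first edge. The cover of the half of `v`
omitted `v`, so it contains the neighbor `w'`; the resulting minimal cover contains both `v` and
`w'`. -/
theorem IsExclusiveEdge.unique [Finite V] (hA : A.IsTree) (h : IsExclusiveEdge A v w)
    (h' : IsExclusiveEdge A v w') : w = w' := by
  by_contra hne
  obtain ⟨S, hS⟩ := exists_isSplit hA h.1
  obtain ⟨hv, hw⟩ := hS.isExclusiveEdge_iff.1 h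
  obtain ⟨C₁, h1⟩ := exists_isMinVertexCover (A.induce S)
  obtain ⟨C₂, h2⟩ := exists_isMinVertexCover (A.induce Sᶜ)
  obtain ⟨C, hC, hvC, -, hsub, -⟩ := hS.exists_isMinVertexCover_insert hv hw h1 h2
  have hw' : w' ∈ S := by
    by_contra hc
    exact hne ((hS.adj_iff v hS.left_mem w' hc).1 h'.1).2.symm
  have hadj : (A.induce S).Adj ⟨v, hS.left_mem⟩ ⟨w', hw'⟩ := h'.1
  exact h'.2.2.2 C hC ⟨hvC, hsub _ ((h1.1 hadj).resolve_left (hv C₁ h1))⟩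

/-- Cut at any edge at `v`. Either it is red, or minimal covers restrict to the halves, `v` is
degenerate in its half, and a red edge found there by induction stays red in `A`. -/
theorem exists_isExclusiveEdge (n : ℕ) : ∀ {V : Type*} [Finite V] {A : SimpleGraph V} {v : V},
    Nat.card V = n → A.IsTree → v ∈ degenerateVertices A → ∃ w, IsExclusiveEdge A v w := by
  induction n using Nat.strong_induction_on with
  | _ n ih =>
  intro V _ A v hn hA hv
  -- An isolated vertex could be erased from any cover, hence would be green.
  obtain ⟨w, hw⟩ : ∃ w, A.Adj v w := by
    by_contra! hc
    obtain ⟨C, hC, hvC⟩ := exists_of_notMem_negativeBackbone hv.2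
    classical
    have : A.IsVertexCover (C.erase v : Set V) := by
      intro a b hab
      rcases hC.1 hab with h | h
      · refine .inl ?_
        simp only [Finset.coe_erase, Set.mem_sdiff, h, Set.mem_singleton_iff, true_and]
        rintro rfl
        exact hc b hab
      · refine .inr ?_
        simp only [Finset.coe_erase, Set.mem_sdiff, h, Set.mem_singleton_iff, true_and]
        rintro rfl
        exact hc a hab.symm
    have h1 := hC.2 _ this
    have h2 := Finset.card_erase_lt_of_mem hvC
    omega
  obtain ⟨S, h⟩ := exists_isSplit hA hw
  by_cases hg : ⟨v, h.left_mem⟩ ∈ negativeBackbone (A.induce S) ∧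
      ⟨w, h.right_mem⟩ ∈ negativeBackbone (A.induce Sᶜ)
  · exact ⟨w, h.isExclusiveEdge_iff.2 hg⟩
  have hw2 : ⟨w, h.right_mem⟩ ∉ negativeBackbone (A.induce Sᶜ) := by
    refine fun hw2 => hv.1 fun C hC => ?_
    refine ((h.isVertexCover_iff.1 hC.1).2.2).resolve_right fun hwC => ?_
    exact hw2 _ (h.isMinVertexCover_restrict hg hC).2 (by simpa using hwC)
  have hv1 : ⟨v, h.left_mem⟩ ∉ negativeBackbone (A.induce S) := fun hv1 =>
    hv.2 (h.mem_negativeBackbone_iff.2 ⟨hv1, hw2⟩)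
  have hvS : ⟨v, h.left_mem⟩ ∈ degenerateVertices (A.induce S) := by
    refine ⟨fun hp => hv.1 fun C hC => ?_, hv1⟩
    simpa using hp _ (h.isMinVertexCover_restrict hg hC).1
  have hlt : Nat.card S < n := by
    rw [← hn]
    have := Fintype.ofFinite V
    classical
    rw [Nat.card_eq_fintype_card, Nat.card_eq_fintype_card]
    exact Fintype.card_subtype_lt (p := (· ∈ S)) h.right_mem
  obtain ⟨⟨x, hx⟩, he⟩ := ih _ hlt rfl h.left_tree hvS
  have hex : ∀ C, IsMinVertexCover A C → ¬ (v ∈ C ∧ x ∈ C) := fun C hC hvx =>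
    he.2.2.2 _ (h.isMinVertexCover_restrict hg hC).1 (by simpa using hvx)
  obtain ⟨C, hC, hvC⟩ := exists_of_notMem_negativeBackbone hv.2
  obtain ⟨D, hD, hvD⟩ := exists_of_notMem_positiveBackbone hv.1
  have hadj : A.Adj v x := he.1
  exact ⟨x, hadj, hv, ⟨fun hp => hex C hC ⟨hvC, hp C hC⟩,
    fun hn => hn D hD ((hD.1 hadj).resolve_left hvD)⟩, hex⟩

theorem IsMinVertexCover.map_iso {W : Type*} {B : SimpleGraph W} (e : A ≃g B)
    (hC : IsMinVertexCover A C) : IsMinVertexCover B (C.map e.toEquiv.toEmbedding) := by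
  refine ⟨?_, fun D hD => ?_⟩
  · rw [Finset.coe_map]
    exact (isVertexCover_image_iso e).2 hC.1
  · rw [Finset.card_map, ← Finset.card_map e.symm.toEquiv.toEmbedding (s := D)]
    refine hC.2 _ ?_
    rw [Finset.coe_map]
    exact (isVertexCover_image_iso e.symm).2 hD

theorem map_mem_negativeBackbone {W : Type*} {B : SimpleGraph W} (e : A ≃g B)
    (hv : v ∈ negativeBackbone A) : e v ∈ negativeBackbone B := by
  intro C hC hvC
  refine hv _ (hC.map_iso e.symm) ?_
  rw [Finset.mem_map]
  exact ⟨e v, hvC, e.symm_apply_apply v⟩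

end Cover

end TreeColoring

/-! ### Counting rooted trees by splitting -/

namespace TreeColoring

open SimpleGraph

section Count

/-- A choice of a set of vertices in every graph that is compatible with isomorphisms. -/
structure VertexFamily where
  /-- The set of vertices chosen in a graph. -/
  set : ∀ {V : Type}, SimpleGraph V → Set V
  map_mem : ∀ {V W : Type} {A : SimpleGraph V} {B : SimpleGraph W} (e : A ≃g B) {v : V},
    v ∈ set A → e v ∈ set B

/-- All vertices. -/
def allVertices : VertexFamily where
  set _ := Set.univ
  map_mem _ _ _ := trivial

/-- The green vertices. -/
def greenVertices : VertexFamily where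
  set A := negativeBackbone A
  map_mem e _ h := map_mem_negativeBackbone e h

/-- The vertices that are not green. -/
def nongreenVertices : VertexFamily where
  set A := (negativeBackbone A)ᶜ
  map_mem e v hv h := hv (by simpa using map_mem_negativeBackbone e.symm h)

/-- The trees on `V` with a root in the family `P`. -/
def rootedTrees (P : VertexFamily) (V : Type) : Set (SimpleGraph V × V) :=
  {p | p.1.IsTree ∧ p.2 ∈ P.set p.1}

/-- The number of labeled trees on `n` vertices with a root in the family `P`. -/
noncomputable def rootedCount (P : VertexFamily) (n : ℕ) : ℕ := Nat.card (rootedTrees P (Fin n))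

variable {V : Type} {P Q R : VertexFamily}

theorem card_rootedTrees [Finite V] (P : VertexFamily) :
    Nat.card (rootedTrees P V) = rootedCount P (Nat.card V) := by
  have e := Finite.equivFin V
  refine Nat.card_congr (Equiv.subtypeEquiv (e.simpleGraph.prodCongr e) ?_)
  rintro ⟨A, v⟩
  obtain ⟨i, hi⟩ : ∃ i : A ≃g e.simpleGraph A, i v = e v := ⟨(Iso.comap e.symm A).symm, rfl⟩
  refine and_congr i.isTree_iff ⟨fun h => ?_, fun h => ?_⟩
  · have := P.map_mem i h
    rwa [hi] at this
  · have : i v ∈ P.set (e.simpleGraph A) := by rw [hi]; exact h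
    simpa using P.map_mem i.symm this

/-- The graph on `V` formed by a graph on `S`, a graph on the complement and the edge `{v, w}`. -/
def glue {S : Set V} (A₁ : SimpleGraph S) (A₂ : SimpleGraph ↥Sᶜ) (v : S) (w : ↥Sᶜ) :
    SimpleGraph V where
  Adj x y := (∃ hx hy, A₁.Adj ⟨x, hx⟩ ⟨y, hy⟩) ∨ (∃ hx hy, A₂.Adj ⟨x, hx⟩ ⟨y, hy⟩) ∨
    (x = v ∧ y = w) ∨ (x = w ∧ y = v)
  symm := ⟨by
    rintro x y (⟨hx, hy, h⟩ | ⟨hx, hy, h⟩ | ⟨hx, hy⟩ | ⟨hx, hy⟩)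
    · exact .inl ⟨hy, hx, h.symm⟩
    · exact .inr (.inl ⟨hy, hx, h.symm⟩)
    · exact .inr (.inr (.inr ⟨hy, hx⟩))
    · exact .inr (.inr (.inl ⟨hy, hx⟩))⟩
  loopless := ⟨by
    rintro x (⟨hx, hy, h⟩ | ⟨hx, hy, h⟩ | ⟨hx, hy⟩ | ⟨hx, hy⟩)
    · exact h.ne rfl
    · exact h.ne rfl
    · exact w.2 (hy ▸ hx ▸ v.2)
    · exact w.2 (hx ▸ hy ▸ v.2)⟩

section Glue

variable {S : Set V} {A₁ : SimpleGraph S} {A₂ : SimpleGraph ↥Sᶜ} {v : S} {w : ↥Sᶜ}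

theorem induce_glue_left : (glue A₁ A₂ v w).induce S = A₁ := by
  ext ⟨x, hx⟩ ⟨y, hy⟩
  have hw := w.2
  simp only [glue, comap_adj, Function.Embedding.subtype_apply]
  constructor
  · rintro (⟨_, _, h⟩ | ⟨h, _⟩ | ⟨_, rfl⟩ | ⟨rfl, _⟩)
    · exact h
    · exact absurd hx h
    · exact absurd hy hw
    · exact absurd hx hw
  · exact fun h => .inl ⟨hx, hy, h⟩

theorem induce_glue_right : (glue A₁ A₂ v w).induce Sᶜ = A₂ := by
  ext ⟨x, hx⟩ ⟨y, hy⟩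
  have hv := v.2
  simp only [glue, comap_adj, Function.Embedding.subtype_apply]
  constructor
  · rintro (⟨h, _⟩ | ⟨_, _, h⟩ | ⟨rfl, _⟩ | ⟨_, rfl⟩)
    · exact absurd h hx
    · exact h
    · exact absurd hv hx
    · exact absurd hv hy
  · exact fun h => .inr (.inl ⟨hx, hy, h⟩)

theorem isSplit_glue (h₁ : A₁.IsTree) (h₂ : A₂.IsTree) : IsSplit (glue A₁ A₂ v w) S v w where
  left_mem := v.2
  right_mem := w.2
  left_tree := by rwa [induce_glue_left]
  right_tree := by rwa [induce_glue_right]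
  adj_iff x hx y hy := by
    have hw := w.2
    constructor
    · rintro (⟨_, h, _⟩ | ⟨h, _⟩ | h | ⟨rfl, _⟩)
      · exact absurd h hy
      · exact absurd hx h
      · exact h
      · exact absurd hx hw
    · exact fun h => .inr (.inr (.inl h))

end Glue

theorem IsSplit.eq_of_induce_eq {A B : SimpleGraph V} {S : Set V} {v w : V} (hA : IsSplit A S v w)
    (hB : IsSplit B S v w) (h₁ : A.induce S = B.induce S) (h₂ : A.induce Sᶜ = B.induce Sᶜ) :
    A = B := by
  ext x y
  by_cases hx : x ∈ S <;> by_cases hy : y ∈ S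
  · exact (congrArg (fun G : SimpleGraph S => G.Adj ⟨x, hx⟩ ⟨y, hy⟩) h₁).to_iff
  · rw [hA.adj_iff x hx y hy, hB.adj_iff x hx y hy]
  · rw [A.adj_comm, B.adj_comm, hA.adj_iff y hy x hx, hB.adj_iff y hy x hx]
  · exact (congrArg (fun G : SimpleGraph ↥Sᶜ => G.Adj ⟨x, hx⟩ ⟨y, hy⟩) h₂).to_iff

/-- The trees split by an edge `{v, w}` along `S`, with `v` and `w` in prescribed families of
vertices of the two parts. -/
def splitTrees (P Q : VertexFamily) (S : Set V) : Set (SimpleGraph V × V × V) :=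
  {t | ∃ h : IsSplit t.1 S t.2.1 t.2.2, ⟨t.2.1, h.left_mem⟩ ∈ P.set (t.1.induce S) ∧
    ⟨t.2.2, h.right_mem⟩ ∈ Q.set (t.1.induce Sᶜ)}

theorem card_splitTrees [Finite V] (P Q : VertexFamily) (S : Set V) :
    Nat.card (splitTrees P Q S) =
      rootedCount P (Nat.card S) * rootedCount Q (Nat.card ↥Sᶜ) := by
  rw [← card_rootedTrees, ← card_rootedTrees, ← Nat.card_prod]
  refine Nat.card_eq_of_bijective (fun t : splitTrees P Q S =>
    ((⟨(t.1.1.induce S, ⟨t.1.2.1, t.2.1.left_mem⟩), t.2.1.left_tree, t.2.2.1⟩ : rootedTrees P S),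
      (⟨(t.1.1.induce Sᶜ, ⟨t.1.2.2, t.2.1.right_mem⟩), t.2.1.right_tree, t.2.2.2⟩ :
        rootedTrees Q ↥Sᶜ))) ⟨?_, ?_⟩
  · rintro ⟨⟨A, v, w⟩, hA, hA'⟩ ⟨⟨B, v', w'⟩, hB, hB'⟩ h
    have h1 : A.induce S = B.induce S := congrArg (fun q => q.1.1.1) h
    have h2 : A.induce Sᶜ = B.induce Sᶜ := congrArg (fun q => q.2.1.1) h
    have h3 : v = v' := congrArg (fun q => (q.1.1.2 : V)) h
    have h4 : w = w' := congrArg (fun q => (q.2.1.2 : V)) h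
    simp only at hA hB
    subst h3 h4
    obtain rfl : A = B := hA.eq_of_induce_eq hB h1 h2
    rfl
  · rintro ⟨⟨⟨A₁, v⟩, h₁, hv⟩, ⟨⟨A₂, w⟩, h₂, hw⟩⟩
    refine ⟨⟨(glue A₁ A₂ v w, v, w), isSplit_glue h₁ h₂, ?_, ?_⟩, ?_⟩
    · simp only [induce_glue_left]
      exact hv
    · simp only [induce_glue_right]
      exact hw
    · simp only [induce_glue_left, induce_glue_right]

theorem sum_set_eq_sum_choose [Fintype V] [Fintype (Set V)] (f : ℕ → ℕ → ℕ) :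
    ∑ S : Set V, f (Nat.card S) (Nat.card ↥Sᶜ) =
      ∑ k ∈ Finset.range (Nat.card V + 1), (Nat.card V).choose k * f k (Nat.card V - k) := by
  classical
  have h : ∀ S : Set V, Nat.card ↥Sᶜ = Nat.card V - Nat.card S := fun S => by
    rw [Nat.card_coe_set_eq, Nat.card_coe_set_eq, Set.ncard_compl]
  simp only [h]
  rw [← Equiv.sum_comp Fintype.finsetEquivSet]
  simp only [Fintype.coe_finsetEquivSet, Nat.card_coe_set_eq, Set.ncard_coe_finset]
  rw [← Finset.powerset_univ,
    Finset.sum_powerset_apply_card (fun m => f m (Nat.card V - m)), Finset.card_univ,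
    Nat.card_eq_fintype_card]
  simp

/-- Double count of trees with root `v` in `R` and a marked vertex `x ≠ v`. Splitting at the edge
from `v` towards `x` leaves a tree rooted at `v` and a tree rooted at `w` with `x` marked in it,
which accounts for the factor `n - k`. -/
theorem rootedCount_mul (hR : ∀ {V : Type} [Finite V] {A : SimpleGraph V} {S : Set V} {v w : V}
      (h : IsSplit A S v w), v ∈ R.set A ↔ ⟨v, h.left_mem⟩ ∈ P.set (A.induce S) ∧
        ⟨w, h.right_mem⟩ ∈ Q.set (A.induce Sᶜ)) (n : ℕ) :
    rootedCount R n * (n - 1) = ∑ k ∈ Finset.range (n + 1),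
      n.choose k * (rootedCount P k * (rootedCount Q (n - k) * (n - k))) := by
  classical
  have hS := sum_set_eq_sum_choose (V := Fin n)
    (fun a b => rootedCount P a * (rootedCount Q b * b))
  rw [Nat.card_fin] at hS
  rw [← hS]
  have h1 : ∀ S : Set (Fin n), rootedCount P (Nat.card S) *
      (rootedCount Q (Nat.card ↥Sᶜ) * Nat.card ↥Sᶜ) =
      Nat.card (splitTrees P Q S × ↥Sᶜ) := fun S => by
    rw [Nat.card_prod, card_splitTrees, mul_assoc]
  simp only [h1]
  rw [← Nat.card_sigma]
  have h2 : rootedCount R n * (n - 1) =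
      Nat.card (Σ p : rootedTrees R (Fin n), {x : Fin n // x ≠ p.1.2}) := by
    have := Fintype.ofFinite (rootedTrees R (Fin n))
    rw [Nat.card_sigma]
    simp [Nat.card_eq_fintype_card, rootedCount, Fintype.card_subtype_compl]
  rw [h2]
  symm
  refine Nat.card_eq_of_bijective
    (fun t => ⟨⟨(t.2.1.1.1, t.2.1.1.2.1), t.2.1.2.1.isTree, (hR t.2.1.2.1).2 t.2.1.2.2⟩,
      t.2.2.1, fun h => t.2.2.2 (h ▸ t.2.1.2.1.left_mem)⟩) ⟨?_, ?_⟩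
  · rintro ⟨S, ⟨⟨A, v, w⟩, h, hP⟩, x, hx⟩ ⟨S', ⟨⟨A', v', w'⟩, h', hP'⟩, x', hx'⟩ heq
    simp only [Sigma.mk.injEq] at heq
    obtain ⟨⟨rfl, rfl⟩, heq⟩ := heq
    simp only [heq_eq_eq, Subtype.mk.injEq] at heq
    subst heq
    have hxv : x ≠ v := fun e => hx (e ▸ h.left_mem)
    have := (existsUnique_isSplit_of_ne h.isTree hxv).unique (y₁ := (S, w)) (y₂ := (S', w'))
      ⟨h, hx⟩ ⟨h', hx'⟩
    simp only [Prod.mk.injEq] at this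
    obtain ⟨rfl, rfl⟩ := this
    rfl
  · rintro ⟨⟨⟨A, v⟩, hA, hv⟩, x, hx⟩
    obtain ⟨⟨S, w⟩, ⟨h, hxS⟩, -⟩ := existsUnique_isSplit_of_ne hA hx
    exact ⟨⟨S, ⟨⟨(A, v, w), h, (hR h).1 hv⟩, x, hxS⟩⟩, rfl⟩

theorem rootedCount_all_mul (n : ℕ) :
    rootedCount allVertices n * (n - 1) = ∑ k ∈ Finset.range (n + 1), n.choose k *
      (rootedCount allVertices k * (rootedCount allVertices (n - k) * (n - k))) :=
  rootedCount_mul (fun _ => by simp [allVertices]) n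

theorem rootedCount_green_mul (n : ℕ) :
    rootedCount greenVertices n * (n - 1) = ∑ k ∈ Finset.range (n + 1), n.choose k *
      (rootedCount greenVertices k * (rootedCount nongreenVertices (n - k) * (n - k))) :=
  rootedCount_mul (fun h => h.mem_negativeBackbone_iff) n

/-- A red vertex has exactly one red edge, so red vertices correspond to oriented red edges, that
is, to splits with both ends green in their halves. -/
theorem card_exclusive (n : ℕ) :
    Nat.card {p : SimpleGraph (Fin n) × Fin n // p.1.IsTree ∧ ∃ w, IsExclusiveEdge p.1 p.2 w} =
      ∑ k ∈ Finset.range (n + 1), n.choose k *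
        (rootedCount greenVertices k * rootedCount greenVertices (n - k)) := by
  classical
  have hS := sum_set_eq_sum_choose (V := Fin n)
    (fun a b => rootedCount greenVertices a * rootedCount greenVertices b)
  rw [Nat.card_fin] at hS
  rw [← hS]
  simp only [← card_splitTrees]
  rw [← Nat.card_sigma]
  symm
  refine Nat.card_eq_of_bijective (fun t => ⟨(t.2.1.1, t.2.1.2.1), t.2.2.1.isTree, t.2.1.2.2,
    t.2.2.1.isExclusiveEdge_iff.2 t.2.2.2⟩) ⟨?_, ?_⟩
  · rintro ⟨S, ⟨A, v, w⟩, h, hP⟩ ⟨S', ⟨A', v', w'⟩, h', hP'⟩ heq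
    simp only [Subtype.mk.injEq, Prod.mk.injEq] at heq
    obtain ⟨rfl, rfl⟩ := heq
    obtain rfl : w = w' :=
      (h.isExclusiveEdge_iff.2 hP).unique h.isTree (h'.isExclusiveEdge_iff.2 hP')
    obtain rfl : S = S' := h.unique h'
    rfl
  · rintro ⟨⟨A, v⟩, hA, w, hw⟩
    obtain ⟨S, hS⟩ := exists_isSplit hA hw.1
    exact ⟨⟨S, ⟨(A, v, w), hS, hS.isExclusiveEdge_iff.1 hw⟩⟩, rfl⟩

theorem totalColored_eq_card (c : Color) (n : ℕ) : totalColored c n =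
    Nat.card {p : SimpleGraph (Fin n) × Fin n // p.1.IsTree ∧ p.2 ∈ colorClass p.1 c} := by
  classical
  have e : {p : SimpleGraph (Fin n) × Fin n // p.1.IsTree ∧ p.2 ∈ colorClass p.1 c} ≃
      Σ A : {A : SimpleGraph (Fin n) // A.IsTree}, colorClass A.1 c :=
    { toFun := fun p => ⟨⟨p.1.1, p.2.1⟩, p.1.2, p.2.2⟩
      invFun := fun p => ⟨(p.1.1, p.2.1), p.1.2, p.2.2⟩
      left_inv := fun _ => rfl
      right_inv := fun _ => rfl }
  rw [Nat.card_congr e, Nat.card_sigma]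
  simp only [totalColored, Nat.card_coe_set_eq]

theorem totalColored_green (n : ℕ) : totalColored .green n = rootedCount greenVertices n :=
  totalColored_eq_card .green n

theorem totalColored_red (n : ℕ) : totalColored .red n =
    ∑ k ∈ Finset.range (n + 1), n.choose k *
      (rootedCount greenVertices k * rootedCount greenVertices (n - k)) :=
  (totalColored_eq_card .red n).trans (card_exclusive n)

theorem ncard_colorClass_add {n : ℕ} {A : SimpleGraph (Fin n)} (hA : A.IsTree) :
    (colorClass A .brown).ncard + (colorClass A .red).ncard + (colorClass A .green).ncard = n := by
  have hred : colorClass A .red = degenerateVertices A := by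
    ext v
    exact ⟨fun ⟨w, hw⟩ => hw.2.1, fun hv => exists_isExclusiveEdge _ rfl hA hv⟩
  -- Without a minimal cover every vertex would be both brown and green.
  obtain ⟨C, hC⟩ := exists_isMinVertexCover A
  have h1 : Disjoint (colorClass A .brown) (colorClass A .red) := by
    rw [hred, Set.disjoint_left]
    exact fun v hv hv' => hv'.1 hv
  have h2 : Disjoint (colorClass A .brown ∪ colorClass A .red) (colorClass A .green) := by
    rw [hred, Set.disjoint_left]
    rintro v (hv | hv) hg
    · exact hg C hC (hv C hC)
    · exact hv.2 hg
  rw [← Set.ncard_union_eq h1, ← Set.ncard_union_eq h2]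
  have : colorClass A .brown ∪ colorClass A .red ∪ colorClass A .green = Set.univ := by
    rw [hred, Set.eq_univ_iff_forall]
    intro v
    by_cases hb : v ∈ positiveBackbone A
    · exact .inl (.inl hb)
    · by_cases hg : v ∈ negativeBackbone A
      · exact .inr hg
      · exact .inl (.inr ⟨hb, hg⟩)
  rw [this, Set.ncard_univ, Nat.card_fin]

theorem totalColored_add (n : ℕ) :
    totalColored .brown n + totalColored .red n + totalColored .green n =
      rootedCount allVertices n := by
  classical
  have h : rootedCount allVertices n = ∑ A : {A : SimpleGraph (Fin n) // A.IsTree}, n := by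
    have e : rootedTrees allVertices (Fin n) ≃ {A : SimpleGraph (Fin n) // A.IsTree} × Fin n :=
      { toFun := fun p => (⟨p.1.1, p.2.1⟩, p.1.2)
        invFun := fun p => ⟨(p.1.1, p.2), p.1.2, trivial⟩
        left_inv := fun _ => rfl
        right_inv := fun _ => rfl }
    rw [rootedCount, Nat.card_congr e, Nat.card_prod, Nat.card_fin]
    simp [Nat.card_eq_fintype_card]
  rw [h, totalColored, totalColored, totalColored, ← Finset.sum_add_distrib,
    ← Finset.sum_add_distrib]
  exact Finset.sum_congr rfl fun A _ => ncard_colorClass_add A.2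

theorem rootedCount_green_add (n : ℕ) :
    rootedCount greenVertices n + rootedCount nongreenVertices n =
      rootedCount allVertices n := by
  have h1 : Disjoint (rootedTrees greenVertices (Fin n)) (rootedTrees nongreenVertices (Fin n)) :=
    Set.disjoint_left.2 fun p hp hp' => hp'.2 hp.2
  simp only [rootedCount, Nat.card_coe_set_eq]
  rw [← Set.ncard_union_eq h1]
  congr 1
  ext p
  by_cases hp : p.2 ∈ negativeBackbone p.1 <;>
    simp [rootedTrees, greenVertices, nongreenVertices, allVertices, hp]

theorem rootedCount_zero (P : VertexFamily) : rootedCount P 0 = 0 := by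
  have : IsEmpty (rootedTrees P (Fin 0)) := ⟨fun p => p.1.2.elim0⟩
  simp [rootedCount]

theorem rootedCount_all_one : rootedCount allVertices 1 = 1 := by
  have : Unique (rootedTrees allVertices (Fin 1)) :=
    { default := ⟨(⊥, 0), IsTree.of_subsingleton, trivial⟩
      uniq := fun p => Subtype.ext (Subsingleton.elim _ _) }
  simp [rootedCount]

theorem rootedCount_green_one : rootedCount greenVertices 1 = 1 := by
  have h : (0 : Fin 1) ∈ negativeBackbone (⊥ : SimpleGraph (Fin 1)) := fun C hC h0 => by
    have := hC.2 ∅ (by simp)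
    have h2 := Finset.card_pos.2 ⟨_, h0⟩
    simp at this
    simp [this] at h2
  have : Unique (rootedTrees greenVertices (Fin 1)) :=
    { default := ⟨(⊥, 0), IsTree.of_subsingleton, h⟩
      uniq := fun p => Subtype.ext (Subsingleton.elim _ _) }
  simp [rootedCount]

end Count

end TreeColoring

/-! ### Formal power series: the Euler operator and powers of the tree series -/

namespace TreeColoring

open PowerSeries

section Series

variable {a b c : ℕ → ℕ}

theorem coeff_egf (ha : a 0 = 0) (n : ℕ) : coeff n (egf a) = (a n : ℚ) / (n.factorial : ℚ) := by
  rw [egf, coeff_mk]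
  split_ifs with h
  · simp [h, ha]
  · rfl

theorem egf_congr (h : ∀ n, n ≠ 0 → a n = b n) : egf a = egf b := by
  ext n
  simp only [egf, coeff_mk]
  split_ifs with hn
  · rfl
  · rw [h n hn]

theorem egf_eq_mul (ha : a 0 = 0) (hb : b 0 = 0)
    (h : ∀ n, c n = ∑ k ∈ Finset.range (n + 1), n.choose k * (a k * b (n - k))) :
    egf c = egf a * egf b := by
  ext n
  rw [coeff_egf (by simp [h, ha]), coeff_mul,
    Finset.Nat.sum_antidiagonal_eq_sum_range_succ (fun i j => coeff i (egf a) * coeff j (egf b)),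
    h n, Nat.cast_sum, Finset.sum_div]
  refine Finset.sum_congr rfl fun k hk => ?_
  have hk : k ≤ n := Nat.lt_succ_iff.1 (Finset.mem_range.1 hk)
  rw [coeff_egf ha, coeff_egf hb]
  push_cast
  rw [Nat.cast_choose ℚ hk]
  have h1 : (n.factorial : ℚ) ≠ 0 := by positivity
  have h2 : (k.factorial : ℚ) ≠ 0 := by positivity
  have h3 : ((n - k).factorial : ℚ) ≠ 0 := by positivity
  field_simp

/-- The Euler operator `x d/dx`. -/
noncomputable def euler (f : ℚ⟦X⟧) : ℚ⟦X⟧ := X * derivative ℚ f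

theorem coeff_euler (f : ℚ⟦X⟧) (n : ℕ) : coeff n (euler f) = n * coeff n f := by
  cases n with
  | zero => simp [euler]
  | succ n =>
    rw [euler, coeff_succ_X_mul, coeff_derivative]
    push_cast
    ring

theorem euler_sub (f g : ℚ⟦X⟧) : euler (f - g) = euler f - euler g := by
  simp [euler, mul_sub]

theorem euler_neg (f : ℚ⟦X⟧) : euler (-f) = -euler f := by
  simp [euler]

theorem euler_pow (f : ℚ⟦X⟧) (l : ℕ) : euler (f ^ (l + 1)) = (l + 1) * f ^ l * euler f := by
  rw [euler, derivative_pow, euler]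
  push_cast
  ring

theorem egf_mul_self (ha : a 0 = 0) : egf (fun n => a n * n) = euler (egf a) := by
  ext n
  rw [coeff_euler, coeff_egf ha, coeff_egf (by simp)]
  push_cast
  ring

/-- In degree `n` the equation expresses `(n - 1)` times the coefficient through lower ones, since
both factors of the product vanish in degree zero. The factor vanishes at `n = 1`, so the linear
coefficient must be given. -/
theorem eq_of_euler_eq {f g t : ℚ⟦X⟧} (hf0 : coeff 0 f = 0) (hg0 : coeff 0 g = 0)
    (h1 : coeff 1 f = coeff 1 g) (hf : euler f = f + f * euler (t - f))
    (hg : euler g = g + g * euler (t - g)) : f = g := by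
  ext n
  induction n using Nat.strong_induction_on with
  | _ n ih =>
  rcases Nat.lt_trichotomy n 1 with hn | rfl | hn
  · obtain rfl : n = 0 := by omega
    rw [hf0, hg0]
  · exact h1
  · have key : coeff n (f * euler (t - f)) = coeff n (g * euler (t - g)) := by
      rw [coeff_mul, coeff_mul]
      refine Finset.sum_congr rfl fun p hp => ?_
      rw [Finset.HasAntidiagonal.mem_antidiagonal] at hp
      rw [coeff_euler, coeff_euler, map_sub, map_sub]
      rcases Nat.eq_zero_or_pos p.1 with h | h
      · simp [h, hf0, hg0]
      rcases Nat.eq_zero_or_pos p.2 with h' | h'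
      · simp [h']
      rw [ih p.1 (by omega), ih p.2 (by omega)]
    have ef := congrArg (coeff n) hf
    have eg := congrArg (coeff n) hg
    rw [coeff_euler, map_add] at ef eg
    have hn' : ((n : ℚ) - 1) ≠ 0 := by
      have : (1 : ℚ) < n := by exact_mod_cast hn
      linarith
    apply mul_left_cancel₀ hn'
    linear_combination ef - eg + key

section Tree

variable {T : ℚ⟦X⟧}

theorem coeff_pow_self (h0 : coeff 0 T = 0) (h1 : coeff 1 T = 1) (n : ℕ) :
    coeff n (T ^ n) = 1 := by
  obtain ⟨R, rfl⟩ := X_dvd_iff.2 (by simpa using h0)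
  rw [mul_pow, coeff_X_pow_mul', if_pos le_rfl, Nat.sub_self]
  have : coeff 0 R = 1 := by simpa [coeff_succ_X_mul] using h1
  simp only [coeff_zero_eq_constantCoeff] at this ⊢
  simp [this]

theorem coeff_pow_of_lt (h0 : coeff 0 T = 0) {n l : ℕ} (h : n < l) : coeff n (T ^ l) = 0 := by
  obtain ⟨R, rfl⟩ := X_dvd_iff.2 (by simpa using h0)
  rw [mul_pow, coeff_X_pow_mul', if_neg (by omega)]

/-- Multiplying ϑT = T + TϑT by `l T^(l-1)` gives ϑ(T^l) = l T^l + l/(l+1) ϑ(T^(l+1)). -/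
theorem coeff_pow_succ (hT : euler T = T + T * euler T) (n : ℕ) {l : ℕ} (hl : l ≠ 0) :
    (n : ℚ) * coeff n (T ^ l) =
      l * coeff n (T ^ l) + l / (l + 1) * (n * coeff n (T ^ (l + 1))) := by
  obtain ⟨m, rfl⟩ := Nat.exists_eq_succ_of_ne_zero hl
  have h : ((m : ℚ⟦X⟧) + 2) * euler (T ^ (m + 1)) =
      ((m : ℚ⟦X⟧) + 2) * ((m + 1) * T ^ (m + 1)) + (m + 1) * euler (T ^ (m + 2)) := by
    rw [euler_pow, euler_pow]
    push_cast
    linear_combination ((m : ℚ⟦X⟧) + 2) * (m + 1) * T ^ m * hT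
  have h' := congrArg (coeff n) h
  have e : ∀ (k : ℕ) (f : ℚ⟦X⟧), coeff n ((k : ℚ⟦X⟧) * f) = k * coeff n f := fun k f => by
    rw [← nsmul_eq_mul, map_nsmul, nsmul_eq_mul]
  have e1 := e (m + 1)
  have e2 := e (m + 2)
  push_cast at e1 e2
  rw [map_add, e2, e2, e1, e1, coeff_euler, coeff_euler] at h'
  push_cast
  have : (m : ℚ) + 1 + 1 ≠ 0 := by positivity
  field_simp
  linear_combination h'

/-- This case of Lagrange inversion follows by descent on `l` from `l = n`, where the coefficient is
1: `coeff_pow_succ` reads (n - l) [xⁿ]T^l = (l n/(l+1)) [xⁿ]T^(l+1). -/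
theorem coeff_pow_eq (h0 : coeff 0 T = 0) (h1 : coeff 1 T = 1) (hT : euler T = T + T * euler T)
    {n l : ℕ} (hl : l ≠ 0) (hln : l ≤ n) :
    coeff n (T ^ l) = l / n * (n : ℚ) ^ (n - l) / ((n - l).factorial : ℚ) := by
  obtain ⟨j, rfl⟩ := Nat.exists_eq_add_of_le hln
  rw [Nat.add_sub_cancel_left]
  generalize hn : l + j = n
  have hn0 : (n : ℚ) ≠ 0 := by
    have : n ≠ 0 := by omega
    exact_mod_cast this
  induction j generalizing l with
  | zero =>
    obtain rfl : l = n := hn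
    rw [coeff_pow_self h0 h1]
    simp [hn0]
  | succ j ih =>
    have hr := coeff_pow_succ hT n hl
    rw [ih (Nat.succ_ne_zero l) (by omega) (by omega)] at hr
    have hnl : (n : ℚ) = l + (j + 1) := by
      rw [← hn]
      push_cast
      ring
    have hj : (j : ℚ) + 1 ≠ 0 := by positivity
    have hf : (j.factorial : ℚ) ≠ 0 := by positivity
    have hl1 : (l : ℚ) + 1 ≠ 0 := by positivity
    apply mul_left_cancel₀ hj
    rw [Nat.factorial_succ]
    push_cast at hr ⊢
    have : ((j : ℚ) + 1) * coeff n (T ^ l) =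
      l / (l + 1) * (n * (((l : ℚ) + 1) / n * n ^ j / (j.factorial : ℚ))) := by
      linear_combination hr - coeff n (T ^ l) * hnl
    rw [this]
    field_simp
    ring

theorem coeff_eq (h0 : coeff 0 T = 0) (h1 : coeff 1 T = 1) (hT : euler T = T + T * euler T)
    {n : ℕ} (hn : n ≠ 0) : coeff n T = (n : ℚ) ^ (n - 1) / (n.factorial : ℚ) := by
  have := coeff_pow_eq h0 h1 hT one_ne_zero (Nat.one_le_iff_ne_zero.2 hn)
  rw [pow_one] at this
  rw [this]
  obtain ⟨m, rfl⟩ := Nat.exists_eq_succ_of_ne_zero hn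
  rw [Nat.succ_sub_one, Nat.factorial_succ]
  have : (m : ℚ) + 1 ≠ 0 := by positivity
  push_cast
  field_simp

theorem hasSubst_neg (h0 : coeff 0 T = 0) : HasSubst (-T) :=
  HasSubst.of_constantCoeff_zero' (by simpa using h0)

theorem coeff_subst_neg (h0 : coeff 0 T = 0) {f : ℚ⟦X⟧} (hf : coeff 0 f = 0) (n : ℕ) :
    coeff n (f.subst (-T)) =
      ∑ l ∈ Finset.Icc 1 n, coeff l f * ((-1) ^ l * coeff n (T ^ l)) := by
  rw [coeff_subst' (hasSubst_neg h0), finsum_eq_sum_of_support_subset (s := Finset.Icc 1 n)]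
  · refine Finset.sum_congr rfl fun l _ => ?_
    have : ((-1 : ℚ⟦X⟧)) ^ l = C ((-1) ^ l) := by simp
    rw [neg_pow, this, coeff_C_mul, smul_eq_mul]
  · intro l hl
    rw [Finset.coe_Icc, Set.mem_Icc]
    rw [Function.mem_support] at hl
    constructor
    · by_contra h
      obtain rfl : l = 0 := by omega
      exact hl (by rw [hf, zero_smul])
    · by_contra h
      refine hl ?_
      rw [coeff_pow_of_lt (by simpa using h0) (by omega), smul_zero]

theorem euler_subst_neg (h0 : coeff 0 T = 0) (h1 : coeff 1 T = 1)
    (hT : euler T = T + T * euler T) : euler (-T.subst (-T)) =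
      -T.subst (-T) + -T.subst (-T) * euler (T - -T.subst (-T)) := by
  have hs := hasSubst_neg h0
  have hT0 : T ≠ 0 := by
    rintro rfl
    simp at h1
  have e1 : euler (T.subst (-T)) = -((derivative ℚ T).subst (-T) * euler T) := by
    rw [euler, derivative_subst hs, euler, map_neg]
    ring
  have e2 := congrArg (fun f : ℚ⟦X⟧ => f.subst (-T)) hT
  simp only [euler, subst_add hs, subst_mul hs, subst_X hs] at e2
  rw [euler_neg, euler_sub, euler_neg, e1]
  set D : ℚ⟦X⟧ := (derivative ℚ T).subst (-T)
  set N : ℚ⟦X⟧ := T.subst (-T)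
  -- The chain rule gives ϑN = -D ϑT, but the substituted equation `e2` involves `D` only through
  -- the product `T D`; hence the extra factor `T`.
  apply mul_left_cancel₀ hT0
  linear_combination -(euler T * e2) - N * hT

end Tree

end Series

end TreeColoring

/-! ### Generating functions, closed formulas and first terms -/

namespace TreeColoring

open PowerSeries

section TreeSeries

theorem rootedCount_mul_self (P : VertexFamily) {n : ℕ} (h : rootedCount P 0 = 0) :
    rootedCount P n * n = rootedCount P n + rootedCount P n * (n - 1) := by
  cases n with
  | zero => simp [h]
  | succ n => rw [Nat.succ_sub_one]; ring

theorem egf_add {a b c : ℕ → ℕ} (h : ∀ n, c n = a n + b n) : egf c = egf a + egf b := by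
  ext n
  simp only [egf, coeff_mk, map_add]
  split_ifs
  · simp
  · rw [h n]
    push_cast
    ring

theorem coeff_zero_egf (a : ℕ → ℕ) : coeff 0 (egf a) = 0 := by simp [egf]

theorem coeff_one_egf {a : ℕ → ℕ} (h : a 1 = 1) : coeff 1 (egf a) = 1 := by simp [egf, h]

theorem euler_egf_rootedCount_all : euler (egf (rootedCount allVertices)) =
    egf (rootedCount allVertices) +
      egf (rootedCount allVertices) * euler (egf (rootedCount allVertices)) := by
  rw [← egf_mul_self (rootedCount_zero _), ← egf_eq_mul (rootedCount_zero _) (by simp)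
    rootedCount_all_mul]
  exact egf_add fun n => rootedCount_mul_self _ (rootedCount_zero _)

/-- Cayley's formula in rooted form, obtained from the splitting recurrence through the coefficient
formula. -/
theorem rootedCount_all {n : ℕ} (hn : n ≠ 0) : rootedCount allVertices n = n ^ (n - 1) := by
  have h := coeff_eq (coeff_zero_egf _) (coeff_one_egf rootedCount_all_one)
    euler_egf_rootedCount_all hn
  rw [coeff_egf (rootedCount_zero _)] at h
  have hf : (n.factorial : ℚ) ≠ 0 := by positivity
  rw [div_left_inj' hf] at h
  exact_mod_cast h

theorem egf_rootedCount_all : egf (rootedCount allVertices) = treeSeries :=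
  egf_congr fun _ hn => rootedCount_all hn

theorem coeff_zero_treeSeries : coeff 0 treeSeries = 0 := coeff_zero_egf _

theorem coeff_one_treeSeries : coeff 1 treeSeries = 1 := coeff_one_egf (by simp)

theorem euler_treeSeries : euler treeSeries = treeSeries + treeSeries * euler treeSeries := by
  rw [← egf_rootedCount_all]
  exact euler_egf_rootedCount_all

theorem euler_colorSeries_green : euler (colorSeries .green) =
    colorSeries .green + colorSeries .green * euler (treeSeries - colorSeries .green) := by
  have hg : colorSeries .green = egf (rootedCount greenVertices) :=
    congrArg egf (funext totalColored_green)
  have hi : treeSeries - colorSeries .green = egf (rootedCount nongreenVertices) := by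
    rw [hg, ← egf_rootedCount_all, sub_eq_iff_eq_add, add_comm]
    exact egf_add fun n => (rootedCount_green_add n).symm
  rw [hi, hg, ← egf_mul_self (rootedCount_zero _), ← egf_mul_self (rootedCount_zero _),
    ← egf_eq_mul (rootedCount_zero _) (by simp) rootedCount_green_mul]
  exact egf_add fun n => rootedCount_mul_self _ (rootedCount_zero _)

theorem coeff_treeSeriesNegTree (n : ℕ) : coeff n treeSeriesNegTree =
    ∑ l ∈ Finset.Icc 1 n, coeff l treeSeries * ((-1) ^ l * coeff n (treeSeries ^ l)) :=
  coeff_subst_neg coeff_zero_treeSeries coeff_zero_treeSeries n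

theorem colorSeries_green : colorSeries .green = -treeSeriesNegTree := by
  refine eq_of_euler_eq (coeff_zero_egf _) ?_ ?_ euler_colorSeries_green
    (euler_subst_neg coeff_zero_treeSeries coeff_one_treeSeries euler_treeSeries)
  · rw [map_neg, coeff_treeSeriesNegTree]
    simp
  · rw [map_neg, coeff_treeSeriesNegTree, colorSeries,
      coeff_one_egf (by rw [totalColored_green, rootedCount_green_one])]
    simp [coeff_one_treeSeries]

theorem totalColored_red_eq (n : ℕ) : totalColored .red n = ∑ k ∈ Finset.range (n + 1),
    n.choose k * (totalColored .green k * totalColored .green (n - k)) := by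
  simp only [totalColored_green, totalColored_red]

theorem totalColored_green_zero : totalColored .green 0 = 0 := by
  rw [totalColored_green, rootedCount_zero]

theorem totalColored_brown_add {n : ℕ} (hn : n ≠ 0) :
    totalColored .brown n + totalColored .red n + totalColored .green n = n ^ (n - 1) := by
  rw [totalColored_add, rootedCount_all hn]

theorem colorSeries_red_eq_sq : colorSeries .red = colorSeries .green ^ 2 := by
  rw [sq]
  exact egf_eq_mul totalColored_green_zero totalColored_green_zero totalColored_red_eq

theorem colorSeries_red : colorSeries .red = treeSeriesNegTree ^ 2 := by
  rw [colorSeries_red_eq_sq, colorSeries_green, neg_sq]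

theorem colorSeries_brown : colorSeries .brown =
    treeSeries + treeSeriesNegTree - treeSeriesNegTree ^ 2 := by
  have h : colorSeries .brown + colorSeries .red + colorSeries .green = treeSeries := by
    rw [← egf_rootedCount_all, colorSeries, colorSeries, colorSeries,
      ← egf_add (fun n => rfl), ← egf_add (fun n => rfl)]
    exact congrArg egf (funext totalColored_add)
  rw [colorSeries_red, colorSeries_green] at h
  linear_combination h

theorem coeff_treeSeries {n : ℕ} (hn : n ≠ 0) :
    coeff n treeSeries = (n : ℚ) ^ (n - 1) / (n.factorial : ℚ) :=
  coeff_eq coeff_zero_treeSeries coeff_one_treeSeries euler_treeSeries hn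

/-- The coefficient formula for the composition of a series with `-T`. -/
theorem coeff_subst_neg_treeSeries {f : ℚ⟦X⟧} (hf : coeff 0 f = 0) {g : ℕ → ℚ}
    (hg : ∀ l, l ≠ 0 → coeff l f = g l * coeff l treeSeries) {n : ℕ} (hn : n ≠ 0) :
    (n.factorial : ℚ) * coeff n (f.subst (-treeSeries)) / (n : ℚ) ^ (n - 1) =
      ∑ l ∈ Finset.Icc 1 n, (-(l : ℚ) / (n : ℚ)) ^ l * g l * (n.choose l : ℚ) := by
  rw [coeff_subst_neg coeff_zero_treeSeries hf, Finset.mul_sum, Finset.sum_div]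
  refine Finset.sum_congr rfl fun l hl => ?_
  rw [Finset.mem_Icc] at hl
  have hl0 : l ≠ 0 := by omega
  rw [hg l hl0, coeff_treeSeries hl0, coeff_pow_eq coeff_zero_treeSeries coeff_one_treeSeries
    euler_treeSeries hl0 hl.2, Nat.cast_choose ℚ hl.2, div_pow, neg_pow]
  obtain ⟨m, rfl⟩ := Nat.exists_eq_succ_of_ne_zero hl0
  obtain ⟨j, rfl⟩ := Nat.exists_eq_add_of_le hl.2
  have e1 : m.succ + j - 1 = m + j := by omega
  have e2 : m.succ + j - m.succ = j := by omega
  rw [e1, e2, Nat.succ_sub_one]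
  generalize hN : ((m.succ + j : ℕ) : ℚ) = N
  have hN0 : N ≠ 0 := by
    rw [← hN]
    positivity
  have h1 : ((m.succ).factorial : ℚ) ≠ 0 := by positivity
  have h2 : (j.factorial : ℚ) ≠ 0 := by positivity
  field_simp
  simp only [Nat.succ_eq_add_one, pow_succ, pow_add]
  ring

theorem factorial_mul_coeff_colorSeries {c : Color} {n : ℕ} (hn : n ≠ 0) :
    (n.factorial : ℚ) * coeff n (colorSeries c) = totalColored c n := by
  have : (n.factorial : ℚ) ≠ 0 := by positivity
  rw [colorSeries, egf, coeff_mk, if_neg hn]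
  field_simp

theorem totalColored_green_div {n : ℕ} (hn : n ≠ 0) :
    (totalColored .green n : ℚ) / (n : ℚ) ^ (n - 1) =
      -∑ l ∈ Finset.Icc 1 n, (-(l : ℚ) / (n : ℚ)) ^ l * (n.choose l : ℚ) := by
  have h := coeff_subst_neg_treeSeries coeff_zero_treeSeries (g := fun _ => 1)
    (fun l _ => (one_mul _).symm) hn
  simp only [mul_one] at h
  rw [← factorial_mul_coeff_colorSeries hn, colorSeries_green, ← h, treeSeriesNegTree, map_neg]
  ring

theorem totalColored_red_div {n : ℕ} (hn : n ≠ 0) :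
    (totalColored .red n : ℚ) / (n : ℚ) ^ (n - 1) =
      -2 * ∑ l ∈ Finset.Icc 1 n,
        (-(l : ℚ) / (n : ℚ)) ^ l * (1 / (l : ℚ) - 1) * (n.choose l : ℚ) := by
  -- The case `l = 1` of `coeff_pow_succ` says that the coefficients of T² are those of T times 2(1
  -- - 1/l).
  have h := coeff_subst_neg_treeSeries (f := treeSeries ^ 2) (g := fun l => -2 * (1 / l - 1))
    (by
      have := coeff_zero_treeSeries
      rw [coeff_zero_eq_constantCoeff] at this ⊢
      simp [this])
    (fun l hl => by
      have := coeff_pow_succ euler_treeSeries l one_ne_zero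
      have hl' : (l : ℚ) ≠ 0 := by exact_mod_cast hl
      norm_num at this
      field_simp
      linear_combination -2 * this) hn
  rw [← factorial_mul_coeff_colorSeries hn, colorSeries_red, treeSeriesNegTree,
    ← subst_pow (hasSubst_neg coeff_zero_treeSeries), h, Finset.mul_sum]
  exact Finset.sum_congr rfl fun l _ => by ring

theorem totalColored_brown_div {n : ℕ} (hn : n ≠ 0) :
    (totalColored .brown n : ℚ) / (n : ℚ) ^ (n - 1) =
      1 + ∑ l ∈ Finset.Icc 1 n,
        (-(l : ℚ) / (n : ℚ)) ^ l * (2 / (l : ℚ) - 1) * (n.choose l : ℚ) := by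
  have h : (totalColored .brown n : ℚ) + totalColored .red n + totalColored .green n =
      (n : ℚ) ^ (n - 1) := by exact_mod_cast totalColored_brown_add hn
  have hp : (n : ℚ) ^ (n - 1) ≠ 0 := pow_ne_zero _ (by exact_mod_cast hn)
  have hb : (totalColored .brown n : ℚ) / (n : ℚ) ^ (n - 1) =
      1 - totalColored .red n / (n : ℚ) ^ (n - 1) - totalColored .green n / (n : ℚ) ^ (n - 1) := by
    rw [← h] at hp ⊢
    field_simp
    ring
  rw [hb, totalColored_red_div hn, totalColored_green_div hn, sub_neg_eq_add, sub_eq_add_neg,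
    add_assoc]
  congr 1
  rw [Finset.mul_sum, ← Finset.sum_neg_distrib, ← Finset.sum_add_distrib]
  exact Finset.sum_congr rfl fun l _ => by ring

theorem totalColored_green_first :
    (List.range 10).map (fun i => totalColored .green (i + 1)) =
      [1, 0, 6, 12, 320, 2190, 51492, 685496, 17286768, 348213690] := by
  have key : ∀ n m : ℕ, n ≠ 0 → (m : ℚ) = (n : ℚ) ^ (n - 1) * (-∑ l ∈ Finset.Icc 1 n,
      (-(l : ℚ) / (n : ℚ)) ^ l * (n.choose l : ℚ)) →
      totalColored .green n = m := fun n m hn h => by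
    have hp : (n : ℚ) ^ (n - 1) ≠ 0 := pow_ne_zero _ (by exact_mod_cast hn)
    have h' := totalColored_green_div hn
    rw [div_eq_iff hp, mul_comm, ← h] at h'
    exact_mod_cast h'
  simp only [List.range_succ, List.range_zero, List.map_cons, List.map_nil, List.nil_append,
    List.cons_append, List.cons.injEq, and_true]
  refine ⟨key 1 1 (by norm_num) ?_,
    key 2 0 (by norm_num) ?_,
    key 3 6 (by norm_num) ?_,
    key 4 12 (by norm_num) ?_,
    key 5 320 (by norm_num) ?_,
    key 6 2190 (by norm_num) ?_,
    key 7 51492 (by norm_num) ?_,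
    key 8 685496 (by norm_num) ?_,
    key 9 17286768 (by norm_num) ?_,
    key 10 348213690 (by norm_num) ?_⟩ <;>
    norm_num [Finset.sum_Icc_succ_top, Nat.choose]

theorem totalColored_red_first :
    (List.range 10).map (fun i => totalColored .red (i + 1)) =
      [0, 2, 0, 48, 120, 4560, 35700, 1048992, 15514128, 456726240] := by
  have key : ∀ n m : ℕ, n ≠ 0 → (m : ℚ) = (n : ℚ) ^ (n - 1) * (-2 * ∑ l ∈ Finset.Icc 1 n,
      (-(l : ℚ) / (n : ℚ)) ^ l * (1 / (l : ℚ) - 1) * (n.choose l : ℚ)) →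
      totalColored .red n = m := fun n m hn h => by
    have hp : (n : ℚ) ^ (n - 1) ≠ 0 := pow_ne_zero _ (by exact_mod_cast hn)
    have h' := totalColored_red_div hn
    rw [div_eq_iff hp, mul_comm, ← h] at h'
    exact_mod_cast h'
  simp only [List.range_succ, List.range_zero, List.map_cons, List.map_nil, List.nil_append,
    List.cons_append, List.cons.injEq, and_true]
  refine ⟨key 1 0 (by norm_num) ?_,
    key 2 2 (by norm_num) ?_,
    key 3 0 (by norm_num) ?_,
    key 4 48 (by norm_num) ?_,
    key 5 120 (by norm_num) ?_,
    key 6 4560 (by norm_num) ?_,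
    key 7 35700 (by norm_num) ?_,
    key 8 1048992 (by norm_num) ?_,
    key 9 15514128 (by norm_num) ?_,
    key 10 456726240 (by norm_num) ?_⟩ <;>
    norm_num [Finset.sum_Icc_succ_top, Nat.choose]

theorem totalColored_brown_first :
    (List.range 10).map (fun i => totalColored .brown (i + 1)) =
      [0, 0, 3, 4, 185, 1026, 30457, 362664, 10245825, 195060070] := by
  have hg := totalColored_green_first
  have hr := totalColored_red_first
  have key : ∀ n g r m : ℕ, n ≠ 0 → totalColored .green n = g → totalColored .red n = r →
      m + r + g = n ^ (n - 1) → totalColored .brown n = m := fun n g r m hn hg hr h => by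
    have := totalColored_brown_add hn
    rw [hg, hr, ← h] at this
    omega
  simp only [List.range_succ, List.range_zero, List.map_cons, List.map_nil, List.nil_append,
    List.cons_append, List.cons.injEq, and_true] at hg hr ⊢
  obtain ⟨g1, g2, g3, g4, g5, g6, g7, g8, g9, g10⟩ := hg
  obtain ⟨r1, r2, r3, r4, r5, r6, r7, r8, r9, r10⟩ := hr
  exact ⟨key _ _ _ _ (by norm_num) g1 r1 (by norm_num),
    key _ _ _ _ (by norm_num) g2 r2 (by norm_num),
    key _ _ _ _ (by norm_num) g3 r3 (by norm_num),
    key _ _ _ _ (by norm_num) g4 r4 (by norm_num),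
    key _ _ _ _ (by norm_num) g5 r5 (by norm_num),
    key _ _ _ _ (by norm_num) g6 r6 (by norm_num),
    key _ _ _ _ (by norm_num) g7 r7 (by norm_num),
    key _ _ _ _ (by norm_num) g8 r8 (by norm_num),
    key _ _ _ _ (by norm_num) g9 r9 (by norm_num),
    key _ _ _ _ (by norm_num) g10 r10 (by norm_num)⟩

end TreeSeries

end TreeColoring

/-! ### Weighted averages and their limits -/

namespace TreeColoring

open Filter Topology

section Convolution

/-- A nonnegative sequence satisfying the recurrence of the weighted tree coefficients, whose
weighting by the index is asymptotically insensitive to shifts. -/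
structure IsTreeLike (t : ℕ → ℝ) : Prop where
  zero : t 0 = 0
  pos : ∀ n, n ≠ 0 → 0 < t n
  rec_eq : ∀ n : ℕ, (n : ℝ) * t n =
    t n + ∑ k ∈ Finset.range (n + 1), t k * (((n - k : ℕ) : ℝ) * t (n - k))
  tendsto_ratio : ∀ k : ℕ,
    Tendsto (fun n : ℕ => ((n - k : ℕ) : ℝ) * t (n - k) / (n * t n)) atTop (𝓝 1)

/-- The average of `d (n - k)` with weights `a k * (n - k) * t (n - k) / (n * t n)`. -/
noncomputable def weightedAvg (t a d : ℕ → ℝ) (n : ℕ) : ℝ :=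
  ∑ k ∈ Finset.range (n + 1), a k * (((n - k : ℕ) : ℝ) * t (n - k) / (n * t n)) * d (n - k)

variable {t a d q e : ℕ → ℝ} {A D M c : ℝ}

namespace IsTreeLike

theorem nonneg (ht : IsTreeLike t) (n : ℕ) : 0 ≤ t n := by
  rcases Nat.eq_zero_or_pos n with rfl | h
  · exact ht.zero.ge
  · exact (ht.pos n h.ne').le

theorem weight_nonneg (ht : IsTreeLike t) (m n : ℕ) : 0 ≤ (m : ℝ) * t m / (n * t n) := by
  have := ht.nonneg m
  have := ht.nonneg n
  positivity

/-- This is the recurrence divided by `n * t n`: the weights attached to `t` are almost a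
probability distribution. -/
theorem weightedAvg_self (ht : IsTreeLike t) {n : ℕ} (hn : n ≠ 0) :
    weightedAvg t t (fun _ => 1) n = 1 - 1 / n := by
  have h := ht.rec_eq n
  have h1 := (ht.pos n hn).ne'
  have h2 : (n : ℝ) ≠ 0 := by exact_mod_cast hn
  have h3 : weightedAvg t t (fun _ => 1) n =
      (∑ k ∈ Finset.range (n + 1), t k * (((n - k : ℕ) : ℝ) * t (n - k))) / (n * t n) := by
    rw [weightedAvg, Finset.sum_div]
    exact Finset.sum_congr rfl fun k _ => by ring
  rw [h3, eq_sub_iff_add_eq'.2 h.symm]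
  field_simp

theorem tendsto_sum_range (ht : IsTreeLike t) (a : ℕ → ℝ) (K : ℕ) :
    Tendsto (fun n : ℕ => ∑ k ∈ Finset.range K,
      a k * (((n - k : ℕ) : ℝ) * t (n - k) / (n * t n))) atTop
      (𝓝 (∑ k ∈ Finset.range K, a k)) := by
  refine tendsto_finsetSum _ fun k _ => ?_
  simpa using (ht.tendsto_ratio k).const_mul (a k)

theorem sum_range_weight_le (ht : IsTreeLike t) {K n : ℕ} (hn : n ≠ 0) (hK : K ≤ n + 1) :
    ∑ k ∈ Finset.range K, t k * (((n - k : ℕ) : ℝ) * t (n - k) / (n * t n)) ≤ 1 := by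
  have h := ht.weightedAvg_self hn
  have h1 : weightedAvg t t (fun _ => 1) n ≤ 1 := by
    rw [h]
    have : (0 : ℝ) ≤ 1 / n := by positivity
    linarith
  refine le_trans ?_ h1
  simp only [weightedAvg, mul_one]
  exact Finset.sum_le_sum_of_subset_of_nonneg (Finset.range_subset_range.2 hK)
    fun k _ _ => mul_nonneg (ht.nonneg k) (ht.weight_nonneg _ _)

/-- For fixed `K` the first `K` weights tend to the `t k`, and their total never exceeds 1. -/
theorem sum_range_le_one (ht : IsTreeLike t) (K : ℕ) : ∑ k ∈ Finset.range K, t k ≤ 1 := by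
  refine le_of_tendsto (ht.tendsto_sum_range t K) ?_
  filter_upwards [eventually_ge_atTop (K + 1)] with n hn
  exact ht.sum_range_weight_le (by omega) (by omega)

theorem summable (ht : IsTreeLike t) : Summable t :=
  summable_of_sum_range_le ht.nonneg ht.sum_range_le_one

theorem weightedAvg_nonneg (ht : IsTreeLike t) (ha : ∀ k, 0 ≤ a k) (hd : ∀ k, 0 ≤ d k) (n : ℕ) :
    0 ≤ weightedAvg t a d n :=
  Finset.sum_nonneg fun k _ =>
    mul_nonneg (mul_nonneg (ha k) (ht.weight_nonneg _ _)) (hd _)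

/-- Cut the sum at `K`. Below `K` the weights tend to `a k` and `d (n - k) ≤ D` eventually. Beyond
`K` the mass is at most what the first `K` weights of `t` leave of 1, which is small because `t`
sums to exactly 1. -/
theorem weightedAvg_eventually_le (ht : IsTreeLike t) (h1 : HasSum t 1) (ha : ∀ k, 0 ≤ a k)
    (hat : ∀ k, a k ≤ t k) (hA : HasSum a A) (hd : ∀ k, 0 ≤ d k) (hdM : ∀ k, d k ≤ M)
    (hD : ∀ᶠ n in atTop, d n ≤ D) {ε : ℝ} (hε : 0 < ε) :
    ∀ᶠ n in atTop, weightedAvg t a d n ≤ A * D + ε := by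
  have hM : 0 ≤ M := (hd 0).trans (hdM 0)
  have hD0 : 0 ≤ D := by
    obtain ⟨n, hn⟩ := hD.exists
    exact (hd n).trans hn
  obtain ⟨K, hK⟩ : ∃ K, M * (1 - ∑ k ∈ Finset.range K, t k) < ε := by
    have : Tendsto (fun K => M * (1 - ∑ k ∈ Finset.range K, t k)) atTop (𝓝 (M * (1 - 1))) :=
      (h1.tendsto_sum_nat.const_sub 1).const_mul M
    rw [sub_self, mul_zero] at this
    exact (this.eventually_lt_const hε).exists
  have hlim := ((ht.tendsto_sum_range a K).const_mul D).add
    (((ht.tendsto_sum_range t K).const_sub 1).const_mul M)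
  have hlt : D * ∑ k ∈ Finset.range K, a k + M * (1 - ∑ k ∈ Finset.range K, t k) <
      A * D + ε := by
    have : ∑ k ∈ Finset.range K, a k ≤ A := sum_le_hasSum _ (fun k _ => ha k) hA
    nlinarith
  obtain ⟨N, hN⟩ := eventually_atTop.1 hD
  filter_upwards [hlim.eventually_lt_const hlt, eventually_ge_atTop (N + K + 1)] with n hn hnN
  refine le_trans ?_ hn.le
  have hw := ht.weightedAvg_self (n := n) (by omega)
  have hn0 : (0 : ℝ) ≤ 1 / n := by positivity
  simp only [weightedAvg, mul_one] at hw ⊢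
  rw [← Finset.sum_range_add_sum_Ico _ (show K ≤ n + 1 by omega)] at hw ⊢
  refine add_le_add ?_ ?_
  · rw [Finset.mul_sum]
    refine Finset.sum_le_sum fun k hk => ?_
    rw [Finset.mem_range] at hk
    rw [mul_comm D]
    exact mul_le_mul_of_nonneg_left (hN _ (by omega))
      (mul_nonneg (ha k) (ht.weight_nonneg _ _))
  · calc _ ≤ M * ∑ k ∈ Finset.Ico K (n + 1),
          t k * (((n - k : ℕ) : ℝ) * t (n - k) / (n * t n)) := by
          rw [Finset.mul_sum]
          refine Finset.sum_le_sum fun k _ => ?_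
          rw [mul_comm M]
          exact mul_le_mul (mul_le_mul_of_nonneg_right (hat k) (ht.weight_nonneg _ _)) (hdM _)
            (hd _) (mul_nonneg (ht.nonneg k) (ht.weight_nonneg _ _))
      _ ≤ _ := mul_le_mul_of_nonneg_left (by linarith) hM

theorem tendsto_weightedAvg_zero (ht : IsTreeLike t) (h1 : HasSum t 1) (ha : ∀ k, 0 ≤ a k)
    (hat : ∀ k, a k ≤ t k) (hd : ∀ k, 0 ≤ d k) (hdM : ∀ k, d k ≤ M)
    (hlim : Tendsto d atTop (𝓝 0)) : Tendsto (weightedAvg t a d) atTop (𝓝 0) := by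
  have hA : Summable a := Summable.of_nonneg_of_le ha hat h1.summable
  have hA0 : 0 ≤ ∑' k, a k := tsum_nonneg ha
  refine tendsto_order.2 ⟨fun x hx => Eventually.of_forall fun n =>
    hx.trans_le (ht.weightedAvg_nonneg ha hd n), fun x hx => ?_⟩
  have hD : 0 < x / (2 * (∑' k, a k + 1)) := by positivity
  filter_upwards [ht.weightedAvg_eventually_le h1 ha hat hA.hasSum hd hdM
    ((hlim.eventually_lt_const hD).mono fun n hn => hn.le) (show 0 < x / 4 by positivity)]
    with n hn
  refine hn.trans_lt ?_
  have : (∑' k, a k) * (x / (2 * (∑' k, a k + 1))) ≤ x / 2 := by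
    rw [mul_div_assoc', div_le_div_iff₀ (by positivity) (by positivity)]
    nlinarith
  linarith

/-- The upper bound applies to `a` and to `t - a`, whose averages add up to `1 - 1/n`; the second
one yields the lower bound. -/
theorem tendsto_weightedAvg_one (ht : IsTreeLike t) (h1 : HasSum t 1) (ha : ∀ k, 0 ≤ a k)
    (hat : ∀ k, a k ≤ t k) (hA : HasSum a A) :
    Tendsto (weightedAvg t a fun _ => 1) atTop (𝓝 A) := by
  have upper : ∀ {b : ℕ → ℝ} {B : ℝ}, (∀ k, 0 ≤ b k) → (∀ k, b k ≤ t k) → HasSum b B →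
      ∀ {ε : ℝ}, 0 < ε → ∀ᶠ n in atTop, weightedAvg t b (fun _ => 1) n ≤ B + ε := by
    intro b B hb hbt hB ε hε
    simpa using ht.weightedAvg_eventually_le h1 hb hbt hB (d := fun _ => 1) (M := 1) (D := 1)
      (by simp) (by simp) (by simp) hε
  refine tendsto_order.2 ⟨fun x hx => ?_, fun x hx => ?_⟩
  · have hε : 0 < (A - x) / 4 := by linarith
    have h2 : ∀ᶠ n : ℕ in atTop, (1 : ℝ) / n < (A - x) / 4 :=
      tendsto_one_div_atTop_nhds_zero_nat.eventually_lt_const hε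
    filter_upwards [upper (b := fun k => t k - a k) (fun k => sub_nonneg.2 (hat k))
      (fun k => sub_le_self _ (ha k)) (h1.sub hA) hε, h2, eventually_ge_atTop 1] with n hn hn2 hn1
    have hw := ht.weightedAvg_self (n := n) (by omega)
    have : weightedAvg t (fun k => t k - a k) (fun _ => 1) n =
        weightedAvg t t (fun _ => 1) n - weightedAvg t a (fun _ => 1) n := by
      simp only [weightedAvg, ← Finset.sum_sub_distrib]
      exact Finset.sum_congr rfl fun k _ => by ring
    linarith
  · filter_upwards [upper ha hat hA (show 0 < (x - A) / 2 by linarith)] with n hn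
    linarith

theorem weightedAvg_sub_const (n : ℕ) : weightedAvg t a (fun m => q m - c) n =
    weightedAvg t a q n - c * weightedAvg t a (fun _ => 1) n := by
  simp only [weightedAvg, Finset.mul_sum, ← Finset.sum_sub_distrib]
  exact Finset.sum_congr rfl fun k _ => by ring

theorem abs_weightedAvg_le (ht : IsTreeLike t) (ha : ∀ k, 0 ≤ a k) (n : ℕ) :
    |weightedAvg t a d n| ≤ weightedAvg t a (fun m => |d m|) n := by
  refine (Finset.abs_sum_le_sum_abs _ _).trans (Finset.sum_le_sum fun k _ => ?_)
  rw [abs_mul, abs_of_nonneg (mul_nonneg (ha k) (ht.weight_nonneg _ _))]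

theorem tendsto_weightedAvg (ht : IsTreeLike t) (h1 : HasSum t 1) (ha : ∀ k, 0 ≤ a k)
    (hat : ∀ k, a k ≤ t k) (hA : HasSum a A) (hM : ∀ k, |q k - c| ≤ M)
    (hlim : Tendsto q atTop (𝓝 c)) : Tendsto (weightedAvg t a q) atTop (𝓝 (c * A)) := by
  have h0 : Tendsto (fun n => |q n - c|) atTop (𝓝 0) := by
    simpa using (hlim.sub_const c).abs
  have h2 := ht.tendsto_weightedAvg_zero h1 ha hat (fun k => abs_nonneg (q k - c)) hM h0
  have h3 : Tendsto (weightedAvg t a fun m => q m - c) atTop (𝓝 0) :=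
    squeeze_zero_norm (fun n => ht.abs_weightedAvg_le ha n) h2
  have h4 := h3.add ((ht.tendsto_weightedAvg_one h1 ha hat hA).const_mul c)
  rw [zero_add] at h4
  refine h4.congr fun n => ?_
  rw [weightedAvg_sub_const]
  ring

/-- A bounded sequence dominated by its weighted average with total weight less than `1`, up to a
null sequence, tends to zero. -/
theorem tendsto_zero_of_le (ht : IsTreeLike t) (h1 : HasSum t 1) (ha : ∀ k, 0 ≤ a k)
    (hat : ∀ k, a k ≤ t k) (hA : HasSum a A) (hA1 : A < 1) (hd : ∀ k, 0 ≤ d k)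
    (hdM : ∀ k, d k ≤ M) (he : Tendsto e atTop (𝓝 0))
    (hle : ∀ᶠ n in atTop, d n ≤ e n + weightedAvg t a d n) : Tendsto d atTop (𝓝 0) := by
  have hA0 : 0 ≤ A := hA.nonneg ha
  have key : ∀ j : ℕ, ∀ᶠ n in atTop, d n ≤ ((1 + A) / 2) ^ j * (M + 1) := by
    intro j
    have hM : 0 ≤ M := (hd 0).trans (hdM 0)
    induction j with
    | zero => exact Eventually.of_forall fun n => by simpa using (hdM n).trans (by linarith)
    | succ j ih =>
      set D := ((1 + A) / 2) ^ j * (M + 1) with hDdef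
      have hD : 0 < D := by positivity
      -- Two such errors, one from the average and one from `e`, leave A D + (1 - A)/2 · D = (1 +
      -- A)/2 · D: each pass shrinks the bound by a fixed factor below 1.
      have hε : 0 < (1 - A) / 4 * D := mul_pos (by linarith) hD
      filter_upwards [ht.weightedAvg_eventually_le h1 ha hat hA hd hdM ih hε, hle,
        he.eventually_lt_const hε] with n hn1 hn2 hn3
      have : ((1 + A) / 2) ^ (j + 1) * (M + 1) = (1 + A) / 2 * D := by
        rw [hDdef]
        ring
      rw [this]
      linarith
  have hlim : Tendsto (fun j : ℕ => ((1 + A) / 2) ^ j * (M + 1)) atTop (𝓝 0) := by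
    simpa using (tendsto_pow_atTop_nhds_zero_of_lt_one (r := (1 + A) / 2) (by linarith)
      (by linarith)).mul_const (M + 1)
  refine tendsto_order.2 ⟨fun x hx => Eventually.of_forall fun n => hx.trans_le (hd n),
    fun x hx => ?_⟩
  obtain ⟨j, hj⟩ := (hlim.eventually_lt_const hx).exists
  exact (key j).mono fun n hn => hn.trans_lt hj

/-- If `p` is one minus its weighted average of total weight `A`, up to a factor tending to `1`,
then it tends to `A / (1 + A)`. -/
theorem tendsto_of_eq_weightedAvg (ht : IsTreeLike t) (h1 : HasSum t 1) (ha : ∀ k, 0 ≤ a k)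
    (hat : ∀ k, a k ≤ t k) (hA : HasSum a A) (hA1 : A < 1) {p : ℕ → ℝ} (hp0 : ∀ n, 0 ≤ p n)
    (hp1 : ∀ n, p n ≤ 1)
    (hp : ∀ n : ℕ, n ≠ 0 → p n = p n / n + weightedAvg t a (fun m => 1 - p m) n) :
    Tendsto p atTop (𝓝 (A / (1 + A))) := by
  have hA0 : 0 ≤ A := hA.nonneg ha
  set c := A / (1 + A) with hc
  -- Since `c` is the fixed point of the limiting equation, subtracting it makes `|p - c|` satisfy
  -- the contraction inequality of `tendsto_zero_of_le`.
  have hcA : c = A * (1 - c) := by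
    rw [hc]
    field_simp
    ring
  have hc0 : 0 ≤ c := by positivity
  have hc1 : c ≤ 1 := by
    rw [hc, div_le_one (by linarith)]
    linarith
  have hlim1 := ht.tendsto_weightedAvg_one h1 ha hat hA
  have he : Tendsto (fun n : ℕ => 1 / (n : ℝ) +
      |(1 - c) * weightedAvg t a (fun _ => 1) n - c|) atTop (𝓝 0) := by
    have h2 := tendsto_one_div_atTop_nhds_zero_nat (𝕜 := ℝ)
    have h3 := ((hlim1.const_mul (1 - c)).sub_const c).abs
    have h4 : (1 - c) * A - c = 0 := by linarith
    rw [h4, abs_zero] at h3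
    simpa using h2.add h3
  have hd : Tendsto (fun n => |p n - c|) atTop (𝓝 0) := by
    refine ht.tendsto_zero_of_le h1 ha hat hA hA1 (fun k => abs_nonneg (p k - c)) (M := 1)
      (fun k => abs_le.2 ⟨by linarith [hp0 k], by linarith [hp1 k]⟩) he ?_
    filter_upwards [eventually_ge_atTop 1] with n hn
    have e1 := hp n (by omega)
    have e2 : weightedAvg t a (fun m => 1 - p m) n =
        (1 - c) * weightedAvg t a (fun _ => 1) n - weightedAvg t a (fun m => p m - c) n := by
      simp only [weightedAvg, Finset.mul_sum, ← Finset.sum_sub_distrib]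
      exact Finset.sum_congr rfl fun k _ => by ring
    have e3 : p n - c = p n / n + ((1 - c) * weightedAvg t a (fun _ => 1) n - c) -
        weightedAvg t a (fun m => p m - c) n := by linarith
    have e4 : |p n / n| ≤ 1 / n := by
      rw [abs_of_nonneg (div_nonneg (hp0 n) (Nat.cast_nonneg n))]
      gcongr
      exact hp1 n
    rw [e3]
    have := abs_sub (p n / n + ((1 - c) * weightedAvg t a (fun _ => 1) n - c))
      (weightedAvg t a (fun m => p m - c) n)
    have := abs_add_le (p n / n) ((1 - c) * weightedAvg t a (fun _ => 1) n - c)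
    have := ht.abs_weightedAvg_le (d := fun m => p m - c) ha n
    linarith
  have := tendsto_zero_iff_abs_tendsto_zero (fun n => p n - c) |>.2 hd
  simpa using this.add_const c

end IsTreeLike

end Convolution

end TreeColoring

/-! ### Evaluating power series at real numbers -/

namespace TreeColoring

open Filter Topology PowerSeries

section Evaluation

/-- The sum of a formal power series at a real number. -/
noncomputable def evalSeries (f : ℚ⟦X⟧) (x : ℝ) : ℝ := ∑' n, ((coeff n f : ℚ) : ℝ) * x ^ n

/-- Absolute convergence at the nonnegative real number `r`. -/
def SummableAt (f : ℚ⟦X⟧) (r : ℝ) : Prop := Summable fun n => |((coeff n f : ℚ) : ℝ)| * r ^ n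

variable {f g a : ℚ⟦X⟧} {r x ρ : ℝ}

theorem SummableAt.mono (h : SummableAt f ρ) (hr : 0 ≤ r) (hrρ : r ≤ ρ) : SummableAt f r :=
  Summable.of_nonneg_of_le (fun n => by positivity) (fun n => by gcongr) h

theorem SummableAt.summable_norm (h : SummableAt f |x|) :
    Summable fun n => ‖((coeff n f : ℚ) : ℝ) * x ^ n‖ := by
  simp only [norm_mul, norm_pow, Real.norm_eq_abs]
  exact h

theorem SummableAt.hasSum (h : SummableAt f |x|) :
    HasSum (fun n => ((coeff n f : ℚ) : ℝ) * x ^ n) (evalSeries f x) :=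
  h.summable_norm.of_norm.hasSum

theorem SummableAt.sub (hf : SummableAt f r) (hg : SummableAt g r) (hr : 0 ≤ r) :
    SummableAt (f - g) r := by
  refine Summable.of_nonneg_of_le (fun n => by positivity) (fun n => ?_) (hf.add hg)
  rw [← add_mul, map_sub]
  push_cast
  exact mul_le_mul_of_nonneg_right (abs_sub _ _) (by positivity)

theorem evalSeries_sub (hf : SummableAt f |x|) (hg : SummableAt g |x|) :
    evalSeries (f - g) x = evalSeries f x - evalSeries g x := by
  refine ((hf.hasSum.sub hg.hasSum).tsum_eq ▸ ?_)
  exact tsum_congr fun n => by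
    rw [map_sub]
    push_cast
    ring

theorem evalSeries_mul (hf : SummableAt f |x|) (hg : SummableAt g |x|) :
    evalSeries (f * g) x = evalSeries f x * evalSeries g x := by
  rw [evalSeries, evalSeries, evalSeries,
    tsum_mul_tsum_eq_tsum_sum_antidiagonal_of_summable_norm hf.summable_norm hg.summable_norm]
  refine tsum_congr fun n => ?_
  rw [coeff_mul]
  push_cast
  rw [Finset.sum_mul]
  refine Finset.sum_congr rfl fun p hp => ?_
  rw [← Finset.HasAntidiagonal.mem_antidiagonal.1 hp, pow_add]
  ring

theorem evalSeries_zero (f : ℚ⟦X⟧) : evalSeries f 0 = ((coeff 0 f : ℚ) : ℝ) := by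
  rw [evalSeries, tsum_eq_single 0 (fun n hn => by simp [hn])]
  simp

theorem evalSeries_X_mul (f : ℚ⟦X⟧) (h : SummableAt (X * f) |x|) :
    evalSeries (X * f) x = x * evalSeries f x := by
  rw [evalSeries, h.summable_norm.of_norm.tsum_eq_zero_add, evalSeries, ← tsum_mul_left]
  simp only [coeff_zero_X_mul, Rat.cast_zero, zero_mul, zero_add, coeff_succ_X_mul]
  exact tsum_congr fun n => by ring

theorem summable_index_mul (h : SummableAt f ρ) (hr : 0 ≤ r) (hrρ : r < ρ) :
    Summable fun n : ℕ => |((coeff n f : ℚ) : ℝ)| * (n * r ^ (n - 1)) := by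
  have hρ : 0 < ρ := hr.trans_lt hrρ
  rw [← summable_nat_add_iff 1]
  obtain ⟨M, hM⟩ : ∃ M, ∀ n, |((coeff n f : ℚ) : ℝ)| * ρ ^ n ≤ M := by
    obtain ⟨M, hM⟩ := h.tendsto_atTop_zero.bddAbove_range
    exact ⟨M, fun n => hM ⟨n, rfl⟩⟩
  have hlt : ‖r / ρ‖ < 1 := by
    rw [Real.norm_of_nonneg (by positivity), div_lt_one hρ]
    exact hrρ
  have hs := ((summable_pow_mul_geometric_of_norm_lt_one 1 hlt).add
    (summable_pow_mul_geometric_of_norm_lt_one 0 hlt)).mul_left (M / ρ)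
  refine Summable.of_nonneg_of_le (fun n => by positivity) (fun n => ?_) hs
  have h1 : |((coeff (n + 1) f : ℚ) : ℝ)| ≤ M / ρ ^ (n + 1) := by
    rw [le_div_iff₀ (by positivity)]
    exact hM (n + 1)
  calc _ ≤ M / ρ ^ (n + 1) * (((n + 1 : ℕ) : ℝ) * r ^ (n + 1 - 1)) := by gcongr
    _ = _ := by
      rw [Nat.add_sub_cancel, div_pow]
      push_cast
      field_simp
      ring

theorem SummableAt.derivative (h : SummableAt f ρ) (hr : 0 ≤ r) (hrρ : r < ρ) :
    SummableAt (derivative ℚ f) r := by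
  refine ((summable_nat_add_iff 1).2 (summable_index_mul h hr hrρ)).congr fun n => ?_
  rw [coeff_derivative]
  push_cast
  rw [abs_mul, abs_of_nonneg (by positivity : (0 : ℝ) ≤ n + 1)]
  ring

theorem hasDerivAt_evalSeries (h : SummableAt f ρ) (hx : |x| < ρ) :
    HasDerivAt (evalSeries f) (evalSeries (derivative ℚ f) x) x := by
  obtain ⟨r, hxr, hrρ⟩ := exists_between hx
  have hr : 0 ≤ r := (abs_nonneg x).trans hxr.le
  have hs := summable_index_mul h hr hrρ
  have hb : ∀ (n : ℕ), ∀ y ∈ Set.Ioo (-r) r,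
      ‖((coeff n f : ℚ) : ℝ) * (n * y ^ (n - 1))‖ ≤
        |((coeff n f : ℚ) : ℝ)| * (n * r ^ (n - 1)) := by
    intro n y hy
    rw [norm_mul, norm_mul, norm_pow, Real.norm_eq_abs, Real.norm_natCast, Real.norm_eq_abs]
    gcongr
    exact (abs_lt.2 hy).le
  have hx' : x ∈ Set.Ioo (-r) r := abs_lt.1 hxr
  have key := hasDerivAt_tsum_of_isPreconnected (t := Set.Ioo (-r) r)
    (g := fun n y => ((coeff n f : ℚ) : ℝ) * y ^ n) hs isOpen_Ioo isPreconnected_Ioo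
    (fun n y _ => (hasDerivAt_pow n y).const_mul _) hb hx'
    (h.mono (abs_nonneg x) hx.le).summable_norm.of_norm hx'
  have hsum : Summable fun n : ℕ => ((coeff n f : ℚ) : ℝ) * (n * x ^ (n - 1)) :=
    Summable.of_norm_bounded hs fun n => hb n x hx'
  rw [hsum.tsum_eq_zero_add] at key
  refine key.congr_deriv ?_
  rw [evalSeries]
  simp only [Nat.cast_zero, zero_mul, mul_zero, zero_add, coeff_derivative]
  refine tsum_congr fun n => ?_
  push_cast
  ring

/-- The function R e^(-a) has zero derivative on the open interval and equals 1 at 0. -/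
theorem evalSeries_eq_exp {R : ℚ⟦X⟧} (hR : derivative ℚ R = R * derivative ℚ a)
    (hR0 : coeff 0 R = 1) (ha0 : coeff 0 a = 0)
    (hRs : ∀ r, 0 ≤ r → r < ρ → SummableAt R r) (has : SummableAt a ρ) (hx : |x| < ρ) :
    evalSeries R x = Real.exp (evalSeries a x) := by
  have hρ : 0 < ρ := (abs_nonneg x).trans_lt hx
  have hd : ∀ y ∈ Set.Ioo (-ρ) ρ,
      HasDerivAt (fun y => evalSeries R y * Real.exp (-evalSeries a y)) 0 y := by
    intro y hy
    have hy' : |y| < ρ := abs_lt.2 hy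
    obtain ⟨s, hys, hsρ⟩ := exists_between hy'
    have hs0 : 0 ≤ s := (abs_nonneg y).trans hys.le
    have h1 := hasDerivAt_evalSeries (hRs s hs0 hsρ) hys
    have h2 := (hasDerivAt_evalSeries has hy').neg.exp
    refine (h1.mul h2).congr_deriv ?_
    rw [hR, evalSeries_mul (hRs _ (abs_nonneg y) hy') (has.derivative (abs_nonneg y) hy')]
    ring
  have hc := isOpen_Ioo.is_const_of_deriv_eq_zero isPreconnected_Ioo
    (fun y hy => (hd y hy).differentiableAt.differentiableWithinAt)
    (fun y hy => (hd y hy).deriv) (abs_lt.1 hx) (show (0 : ℝ) ∈ Set.Ioo (-ρ) ρ by simp [hρ])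
  simp only [evalSeries_zero, hR0, ha0] at hc
  rw [Real.exp_neg] at hc
  field_simp at hc
  simpa using hc

/-- Writing f = X R turns the Euler equation into R' = R a', which integrates to R = e^a. -/
theorem evalSeries_eq_mul_exp (hf0 : coeff 0 f = 0) (hf1 : coeff 1 f = 1) (ha0 : coeff 0 a = 0)
    (hfa : euler f = f + f * euler a) (hfs : SummableAt f ρ) (has : SummableAt a ρ)
    (hx : |x| < ρ) : evalSeries f x = x * Real.exp (evalSeries a x) := by
  obtain ⟨R, rfl⟩ := X_dvd_iff.2 (by simpa using hf0)
  have hR0 : coeff 0 R = 1 := by simpa [coeff_succ_X_mul] using hf1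
  have hR : derivative ℚ R = R * derivative ℚ a := by
    apply mul_left_cancel₀ (pow_ne_zero 2 (X_ne_zero (R := ℚ)))
    simp only [euler, Derivation.leibniz, derivative_X, smul_eq_mul] at hfa
    linear_combination hfa
  -- The coefficients of `f'` are `n + 1` times those of `R`, hence dominate them.
  have hRs : ∀ r, 0 ≤ r → r < ρ → SummableAt R r := by
    intro r hr hrρ
    refine Summable.of_nonneg_of_le (fun n => by positivity) (fun n => ?_)
      (hfs.derivative hr hrρ)
    rw [coeff_derivative, coeff_succ_X_mul]
    push_cast
    rw [abs_mul, abs_of_nonneg (by positivity : (0 : ℝ) ≤ n + 1)]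
    have : |((coeff n R : ℚ) : ℝ)| * 1 ≤ |((coeff n R : ℚ) : ℝ)| * (n + 1) := by
      gcongr
      linarith [(Nat.cast_nonneg n : (0 : ℝ) ≤ n)]
    rw [mul_one] at this
    gcongr
  rw [evalSeries_X_mul _ (hfs.mono (abs_nonneg x) hx.le),
    evalSeries_eq_exp hR hR0 ha0 hRs has hx]

theorem continuousOn_evalSeries (h : SummableAt f ρ) :
    ContinuousOn (evalSeries f) (Set.Icc (-ρ) ρ) := by
  refine continuousOn_tsum (fun n => by fun_prop) h fun n x hx => ?_
  rw [norm_mul, norm_pow, Real.norm_eq_abs, Real.norm_eq_abs]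
  gcongr
  exact abs_le.2 hx

/-- The identity of `evalSeries_eq_mul_exp` on the closed disc of convergence. -/
theorem evalSeries_eq_mul_exp' (hf0 : coeff 0 f = 0) (hf1 : coeff 1 f = 1) (ha0 : coeff 0 a = 0)
    (hfa : euler f = f + f * euler a) (hfs : SummableAt f ρ) (has : SummableAt a ρ)
    (hρ : 0 < ρ) : evalSeries f ρ = ρ * Real.exp (evalSeries a ρ) := by
  have hsub : Set.Ioo (-ρ) ρ ⊆ Set.Icc (-ρ) ρ := Set.Ioo_subset_Icc_self
  have hmem : ρ ∈ Set.Icc (-ρ) ρ := ⟨by linarith, le_rfl⟩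
  have hne : (𝓝[Set.Ioo (-ρ) ρ] ρ).NeBot := by
    rw [← mem_closure_iff_nhdsWithin_neBot, closure_Ioo (by linarith)]
    exact hmem
  have h1 : Tendsto (evalSeries f) (𝓝[Set.Ioo (-ρ) ρ] ρ) (𝓝 (evalSeries f ρ)) :=
    ((continuousOn_evalSeries hfs) ρ hmem).mono_left (nhdsWithin_mono _ hsub)
  have h2 : Tendsto (evalSeries a) (𝓝[Set.Ioo (-ρ) ρ] ρ) (𝓝 (evalSeries a ρ)) :=
    ((continuousOn_evalSeries has) ρ hmem).mono_left (nhdsWithin_mono _ hsub)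
  have h3 : Tendsto (fun x : ℝ => x) (𝓝[Set.Ioo (-ρ) ρ] ρ) (𝓝 ρ) :=
    tendsto_id.mono_left nhdsWithin_le_nhds
  refine tendsto_nhds_unique h1 ((h3.mul (Real.continuous_exp.continuousAt.tendsto.comp h2)).congr'
    ?_)
  filter_upwards [self_mem_nhdsWithin] with x hx
  exact (evalSeries_eq_mul_exp hf0 hf1 ha0 hfa hfs has (abs_lt.2 hx)).symm

end Evaluation

end TreeColoring

/-! ### Limits of the color proportions -/

namespace TreeColoring

open Filter Topology PowerSeries

section Asymptotics

/-- The coefficients of `f` scaled by the radius of convergence `1/e` of the tree series. -/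
noncomputable def scaledCoeff (f : ℚ⟦X⟧) (n : ℕ) : ℝ :=
  ((coeff n f : ℚ) : ℝ) * Real.exp (-1) ^ n

theorem scaledCoeff_euler (f : ℚ⟦X⟧) (n : ℕ) :
    scaledCoeff (euler f) n = n * scaledCoeff f n := by
  rw [scaledCoeff, scaledCoeff, coeff_euler]
  push_cast
  ring

theorem scaledCoeff_mul (f g : ℚ⟦X⟧) (n : ℕ) : scaledCoeff (f * g) n =
    ∑ k ∈ Finset.range (n + 1), scaledCoeff f k * scaledCoeff g (n - k) := by
  rw [scaledCoeff, coeff_mul,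
    Finset.Nat.sum_antidiagonal_eq_sum_range_succ (fun i j => coeff i f * coeff j g)]
  push_cast
  rw [Finset.sum_mul]
  refine Finset.sum_congr rfl fun k hk => ?_
  have hk : k ≤ n := Nat.lt_succ_iff.1 (Finset.mem_range.1 hk)
  rw [scaledCoeff, scaledCoeff, mul_mul_mul_comm, ← pow_add, Nat.add_sub_cancel' hk]

theorem scaledCoeff_add (f g : ℚ⟦X⟧) (n : ℕ) :
    scaledCoeff (f + g) n = scaledCoeff f n + scaledCoeff g n := by
  simp [scaledCoeff, add_mul]

theorem scaledCoeff_treeSeries {n : ℕ} (hn : n ≠ 0) : scaledCoeff treeSeries n =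
    (n : ℝ) ^ (n - 1) / (n.factorial : ℝ) * Real.exp (-1) ^ n := by
  rw [scaledCoeff, coeff_treeSeries hn]
  push_cast
  rfl

theorem index_mul_scaledCoeff_treeSeries (n : ℕ) (hn : n ≠ 0) :
    (n : ℝ) * scaledCoeff treeSeries n =
      (n : ℝ) ^ n / (n.factorial : ℝ) * Real.exp (-1) ^ n := by
  rw [scaledCoeff_treeSeries hn]
  obtain ⟨m, rfl⟩ := Nat.exists_eq_succ_of_ne_zero hn
  simp only [Nat.succ_eq_add_one, Nat.add_sub_cancel, pow_succ]
  ring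

theorem tendsto_index_mul_scaledCoeff_ratio (k : ℕ) : Tendsto (fun n : ℕ =>
    (n : ℝ) * scaledCoeff treeSeries n / ((n + k : ℕ) * scaledCoeff treeSeries (n + k)))
    atTop (𝓝 1) := by
  have hne : ∀ n : ℕ, n ≠ 0 → (n : ℝ) * scaledCoeff treeSeries n ≠ 0 := fun n hn => by
    rw [index_mul_scaledCoeff_treeSeries n hn]
    positivity
  have step : Tendsto (fun n : ℕ => (n : ℝ) * scaledCoeff treeSeries n /
      ((n + 1 : ℕ) * scaledCoeff treeSeries (n + 1))) atTop (𝓝 1) := by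
    -- Since n t_n = nⁿ e^(-n)/n!, the ratio of consecutive terms is e/(1 + 1/n)ⁿ.
    have h := ((Real.tendsto_one_add_div_pow_exp 1).mul_const (Real.exp (-1))).inv₀
      (by positivity)
    rw [← Real.exp_add, add_neg_cancel, Real.exp_zero, inv_one] at h
    refine h.congr' ?_
    filter_upwards [eventually_ge_atTop 1] with n hn
    have hn0 : (n : ℝ) ≠ 0 := by
      have : n ≠ 0 := by omega
      exact_mod_cast this
    have h1 : (n : ℝ) + 1 ≠ 0 := by positivity
    have h2 : (n.factorial : ℝ) ≠ 0 := by positivity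
    rw [index_mul_scaledCoeff_treeSeries n (by omega),
      index_mul_scaledCoeff_treeSeries (n + 1) (by omega), Nat.factorial_succ,
      one_add_div hn0, div_pow]
    push_cast
    rw [pow_succ, pow_succ]
    field_simp
  induction k with
  | zero =>
    refine tendsto_const_nhds.congr' ?_
    filter_upwards [eventually_ge_atTop 1] with n hn
    exact (div_self (hne n (by omega))).symm
  | succ k ih =>
    have h := ih.mul ((tendsto_add_atTop_iff_nat k).2 step)
    rw [mul_one] at h
    refine h.congr' ?_
    filter_upwards [eventually_ge_atTop 1] with n hn
    have h1 := hne (n + k) (by omega)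
    rw [← add_assoc, div_mul_div_cancel₀ h1]

theorem isTreeLike_treeSeries : IsTreeLike (scaledCoeff treeSeries) where
  zero := by simp [scaledCoeff, coeff_zero_treeSeries]
  pos n hn := by
    rw [scaledCoeff_treeSeries hn]
    positivity
  rec_eq n := by
    have h := congrArg (fun f => scaledCoeff f n) euler_treeSeries
    simpa only [scaledCoeff_add, scaledCoeff_mul, scaledCoeff_euler] using h
  tendsto_ratio k := by
    rw [← tendsto_add_atTop_iff_nat k]
    simpa using tendsto_index_mul_scaledCoeff_ratio k

/-- The proportion of vertices of color `c` among all vertices of all trees on `n` vertices. -/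
noncomputable def proportion (c : Color) (n : ℕ) : ℝ :=
  (totalColored c n : ℝ) / (n : ℝ) ^ (n - 1)

theorem proportion_nonneg (c : Color) (n : ℕ) : 0 ≤ proportion c n := by
  unfold proportion
  positivity

theorem proportion_add {n : ℕ} (hn : n ≠ 0) :
    proportion .brown n + proportion .red n + proportion .green n = 1 := by
  have h : (totalColored .brown n : ℝ) + totalColored .red n + totalColored .green n =
      (n : ℝ) ^ (n - 1) := by exact_mod_cast totalColored_brown_add hn
  rw [proportion, proportion, proportion, ← add_div, ← add_div, h]
  exact div_self (pow_ne_zero _ (by exact_mod_cast hn))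

theorem proportion_green_zero : proportion .green 0 = 0 := by
  simp [proportion, totalColored_green_zero]

theorem proportion_green_le_one (n : ℕ) : proportion .green n ≤ 1 := by
  rcases eq_or_ne n 0 with rfl | hn
  · simp [proportion_green_zero]
  · linarith [proportion_add hn, proportion_nonneg .brown n, proportion_nonneg .red n]

theorem scaledCoeff_colorSeries (c : Color) (n : ℕ) :
    scaledCoeff (colorSeries c) n = proportion c n * scaledCoeff treeSeries n := by
  rcases eq_or_ne n 0 with rfl | hn
  · simp [scaledCoeff, coeff_zero_treeSeries, colorSeries, egf]
  · have h0 : (n : ℝ) ≠ 0 := by exact_mod_cast hn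
    rw [scaledCoeff_treeSeries hn, scaledCoeff, colorSeries, egf, coeff_mk, if_neg hn, proportion]
    push_cast
    field_simp

theorem scaledCoeff_green_nonneg (n : ℕ) : 0 ≤ scaledCoeff (colorSeries .green) n := by
  rw [scaledCoeff_colorSeries]
  exact mul_nonneg (proportion_nonneg _ _) (isTreeLike_treeSeries.nonneg n)

theorem scaledCoeff_green_le (n : ℕ) :
    scaledCoeff (colorSeries .green) n ≤ scaledCoeff treeSeries n := by
  rw [scaledCoeff_colorSeries]
  exact mul_le_of_le_one_left (isTreeLike_treeSeries.nonneg n) (proportion_green_le_one n)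

theorem summableAt_of_scaledCoeff {f : ℚ⟦X⟧} (h0 : ∀ n, 0 ≤ scaledCoeff f n)
    (h : Summable (scaledCoeff f)) : SummableAt f (Real.exp (-1)) := by
  refine h.congr fun n => ?_
  rw [← abs_of_nonneg (h0 n), scaledCoeff, abs_mul, abs_of_nonneg (a := Real.exp (-1) ^ n)]
  positivity

theorem summableAt_treeSeries : SummableAt treeSeries (Real.exp (-1)) :=
  summableAt_of_scaledCoeff isTreeLike_treeSeries.nonneg isTreeLike_treeSeries.summable

theorem summable_scaledCoeff_green : Summable (scaledCoeff (colorSeries .green)) :=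
  Summable.of_nonneg_of_le scaledCoeff_green_nonneg scaledCoeff_green_le
    isTreeLike_treeSeries.summable

theorem summableAt_green : SummableAt (colorSeries .green) (Real.exp (-1)) :=
  summableAt_of_scaledCoeff scaledCoeff_green_nonneg summable_scaledCoeff_green

theorem evalSeries_treeSeries {x : ℝ} (hx : |x| < Real.exp (-1)) :
    evalSeries treeSeries x = x * Real.exp (evalSeries treeSeries x) :=
  evalSeries_eq_mul_exp coeff_zero_treeSeries coeff_one_treeSeries coeff_zero_treeSeries
    euler_treeSeries summableAt_treeSeries summableAt_treeSeries hx

/-- The value τ at 1/e satisfies τ = e^(τ - 1), and s + 1 < e^s for s ≠ 0 leaves only τ = 1. -/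
theorem evalSeries_treeSeries_exp : evalSeries treeSeries (Real.exp (-1)) = 1 := by
  have h := evalSeries_eq_mul_exp' coeff_zero_treeSeries coeff_one_treeSeries
    coeff_zero_treeSeries euler_treeSeries summableAt_treeSeries summableAt_treeSeries
    (Real.exp_pos (-1))
  rw [← Real.exp_add] at h
  by_contra hne
  have := Real.add_one_lt_exp (x := -1 + evalSeries treeSeries (Real.exp (-1)))
    (fun h' => hne (by linarith))
  linarith

theorem hasSum_scaledCoeff_treeSeries : HasSum (scaledCoeff treeSeries) 1 := by
  rw [← evalSeries_treeSeries_exp]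
  exact isTreeLike_treeSeries.summable.hasSum

/-- The sum of the green series at `1/e`, which is the omega constant. -/
noncomputable def greenSum : ℝ := ∑' n, scaledCoeff (colorSeries .green) n

theorem hasSum_scaledCoeff_green : HasSum (scaledCoeff (colorSeries .green)) greenSum :=
  summable_scaledCoeff_green.hasSum

/-- At x = 1/e the identity F = x exp(T - F) becomes Ω = exp(-1 + 1 - Ω), as T(1/e) = 1. -/
theorem greenSum_eq : greenSum = Real.exp (-greenSum) := by
  have h1 : coeff 1 (colorSeries .green) = 1 :=
    coeff_one_egf (by rw [totalColored_green, rootedCount_green_one])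
  have h0 : coeff 0 (treeSeries - colorSeries .green) = 0 := by
    rw [map_sub, coeff_zero_treeSeries, colorSeries, coeff_zero_egf, sub_zero]
  have hρ := Real.exp_pos (-1)
  have h := evalSeries_eq_mul_exp' (coeff_zero_egf _) h1 h0 euler_colorSeries_green
    summableAt_green (summableAt_treeSeries.sub summableAt_green hρ.le) hρ
  have ha : |Real.exp (-1)| = Real.exp (-1) := abs_of_pos hρ
  rw [evalSeries_sub (ha.symm ▸ summableAt_treeSeries) (ha.symm ▸ summableAt_green),
    evalSeries_treeSeries_exp, ← Real.exp_add] at h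
  change greenSum = Real.exp (-1 + (1 - greenSum)) at h
  rw [show (-1 + (1 - greenSum) : ℝ) = -greenSum by ring] at h
  exact h

theorem greenSum_pos : 0 < greenSum := greenSum_eq ▸ Real.exp_pos _

theorem greenSum_lt_one : greenSum < 1 := by
  rw [greenSum_eq, Real.exp_lt_one_iff]
  linarith [greenSum_pos]

theorem tendsto_proportion_green :
    Tendsto (proportion .green) atTop (𝓝 (greenSum / (1 + greenSum))) := by
  refine isTreeLike_treeSeries.tendsto_of_eq_weightedAvg hasSum_scaledCoeff_treeSeries
    scaledCoeff_green_nonneg scaledCoeff_green_le hasSum_scaledCoeff_green greenSum_lt_one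
    (proportion_nonneg _) proportion_green_le_one fun n hn => ?_
  have h := congrArg (fun f => scaledCoeff f n) euler_colorSeries_green
  simp only [scaledCoeff_add, scaledCoeff_mul, scaledCoeff_euler] at h
  have ht := (isTreeLike_treeSeries.pos n hn).ne'
  have hn0 : (n : ℝ) ≠ 0 := by exact_mod_cast hn
  have hw : weightedAvg (scaledCoeff treeSeries) (scaledCoeff (colorSeries .green))
      (fun m => 1 - proportion .green m) n = (∑ k ∈ Finset.range (n + 1),
        scaledCoeff (colorSeries .green) k *
          (((n - k : ℕ) : ℝ) * scaledCoeff (treeSeries - colorSeries .green) (n - k))) /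
        (n * scaledCoeff treeSeries n) := by
    rw [weightedAvg, Finset.sum_div]
    refine Finset.sum_congr rfl fun k _ => ?_
    have : scaledCoeff (treeSeries - colorSeries .green) (n - k) =
        scaledCoeff treeSeries (n - k) * (1 - proportion .green (n - k)) := by
      have := scaledCoeff_add (treeSeries - colorSeries .green) (colorSeries .green) (n - k)
      rw [sub_add_cancel, scaledCoeff_colorSeries] at this
      linear_combination -this
    rw [this]
    ring
  rw [hw, eq_sub_iff_add_eq'.2 h.symm, scaledCoeff_colorSeries]
  field_simp
  ring

/-- Compare coefficients in ϑ(F²) = 2FϑF and divide by n t_n. -/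
theorem proportion_red_eq {n : ℕ} (hn : n ≠ 0) : proportion .red n =
    2 * weightedAvg (scaledCoeff treeSeries) (scaledCoeff (colorSeries .green))
      (proportion .green) n := by
  have ht := (isTreeLike_treeSeries.pos n hn).ne'
  have hn0 : (n : ℝ) ≠ 0 := by exact_mod_cast hn
  have he : euler (colorSeries .red) =
      colorSeries .green * euler (colorSeries .green) +
        colorSeries .green * euler (colorSeries .green) := by
    rw [colorSeries_red_eq_sq, euler_pow]
    push_cast
    ring
  have h := congrArg (fun f => scaledCoeff f n) he
  simp only [scaledCoeff_add, scaledCoeff_mul, scaledCoeff_euler] at h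
  have hw : weightedAvg (scaledCoeff treeSeries) (scaledCoeff (colorSeries .green))
      (proportion .green) n = (∑ k ∈ Finset.range (n + 1),
        scaledCoeff (colorSeries .green) k *
          (((n - k : ℕ) : ℝ) * scaledCoeff (colorSeries .green) (n - k))) /
        (n * scaledCoeff treeSeries n) := by
    rw [weightedAvg, Finset.sum_div]
    refine Finset.sum_congr rfl fun k _ => ?_
    rw [scaledCoeff_colorSeries .green (n - k)]
    ring
  rw [scaledCoeff_colorSeries, ← two_mul] at h
  rw [hw, mul_div_assoc', ← h]
  field_simp

theorem tendsto_proportion_red :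
    Tendsto (proportion .red) atTop (𝓝 (2 * (greenSum / (1 + greenSum) * greenSum))) := by
  have hc0 : 0 ≤ greenSum / (1 + greenSum) := by
    have := greenSum_pos
    positivity
  have hc1 : greenSum / (1 + greenSum) ≤ 1 := by
    rw [div_le_one (by linarith [greenSum_pos])]
    linarith
  have h := (isTreeLike_treeSeries.tendsto_weightedAvg hasSum_scaledCoeff_treeSeries
    scaledCoeff_green_nonneg scaledCoeff_green_le hasSum_scaledCoeff_green (M := 1)
    (fun k => abs_le.2 ⟨by linarith [proportion_nonneg .green k],
      by linarith [proportion_green_le_one k]⟩) tendsto_proportion_green).const_mul 2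
  refine h.congr' ?_
  filter_upwards [eventually_ge_atTop 1] with n hn
  exact (proportion_red_eq (by omega)).symm

theorem tendsto_proportion_brown : Tendsto (proportion .brown) atTop
    (𝓝 (1 - 2 * (greenSum / (1 + greenSum) * greenSum) - greenSum / (1 + greenSum))) := by
  refine ((tendsto_proportion_red.const_sub 1).sub tendsto_proportion_green).congr' ?_
  filter_upwards [eventually_ge_atTop 1] with n hn
  linarith [proportion_add (n := n) (by omega)]

end Asymptotics

/-! ### Analytic continuation of T and numerical values -/

section Continuation

/-- The function `y ↦ y e ^ (-y)`, of which the tree function is the inverse. -/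
noncomputable def treeInv (y : ℝ) : ℝ := y * Real.exp (-y)

/-- The inverse of `y ↦ y e ^ (-y)` on `(-∞, 1)`. -/
noncomputable def treeFun : ℝ → ℝ := Function.invFunOn treeInv (Set.Iio 1)

theorem hasDerivAt_treeInv (y : ℝ) : HasDerivAt treeInv ((1 - y) * Real.exp (-y)) y := by
  refine ((hasDerivAt_id y).mul (hasDerivAt_neg y).exp).congr_deriv ?_
  simp
  ring

theorem strictMonoOn_treeInv : StrictMonoOn treeInv (Set.Iic 1) := by
  refine strictMonoOn_of_deriv_pos (convex_Iic 1)
    (fun y _ => (hasDerivAt_treeInv y).continuousAt.continuousWithinAt) fun y hy => ?_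
  rw [interior_Iic, Set.mem_Iio] at hy
  rw [(hasDerivAt_treeInv y).deriv]
  exact mul_pos (by linarith) (Real.exp_pos _)

theorem treeFun_treeInv {y : ℝ} (hy : y < 1) : treeFun (treeInv y) = y :=
  (strictMonoOn_treeInv.injOn.mono Set.Iio_subset_Iic_self).leftInvOn_invFunOn hy

theorem exists_treeInv_eq {x : ℝ} (hx : x < Real.exp (-1)) : ∃ y < 1, treeInv y = x := by
  -- A left endpoint for the intermediate value theorem: a e^(-a) ≤ a ≤ x because a ≤ 0.
  set a := min x 0 with ha
  have ha0 : a ≤ 0 := min_le_right _ _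
  have hax : treeInv a ≤ x := by
    refine le_trans ?_ (min_le_left x 0)
    rw [← ha, treeInv]
    have : 1 ≤ Real.exp (-a) := Real.one_le_exp (by linarith)
    nlinarith
  have h1 : treeInv 1 = Real.exp (-1) := by simp [treeInv]
  obtain ⟨y, hy, rfl⟩ := intermediate_value_Icc (show a ≤ 1 by linarith)
    (fun y _ => (hasDerivAt_treeInv y).continuousAt.continuousWithinAt)
    (show x ∈ Set.Icc (treeInv a) (treeInv 1) from ⟨hax, h1 ▸ hx.le⟩)
  refine ⟨y, lt_of_le_of_ne hy.2 ?_, rfl⟩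
  rintro rfl
  exact hx.ne h1

theorem treeFun_comp_treeInv {y : ℝ} (hy : y < 1) : treeFun ∘ treeInv =ᶠ[𝓝 y] id := by
  filter_upwards [Iio_mem_nhds hy] with z hz
  exact treeFun_treeInv hz

/-- Near `y` the composite with `treeInv` is the identity, and `treeInv` is analytic with nonzero
derivative because y < 1. -/
theorem analyticAt_treeFun {y : ℝ} (hy : y < 1) : AnalyticAt ℝ treeFun (treeInv y) := by
  have hG : AnalyticAt ℝ treeInv y := by
    unfold treeInv
    fun_prop
  refine (analyticAt_comp_iff_of_deriv_ne_zero hG ?_).1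
    (analyticAt_id.congr (treeFun_comp_treeInv hy).symm)
  rw [(hasDerivAt_treeInv y).deriv]
  exact mul_ne_zero (by linarith) (Real.exp_ne_zero _)

theorem deriv_treeFun {y : ℝ} (hy : y < 1) :
    deriv treeFun (treeInv y) = ((1 - y) * Real.exp (-y))⁻¹ := by
  have h1 := (analyticAt_treeFun hy).differentiableAt.hasDerivAt.comp y (hasDerivAt_treeInv y)
  have h2 := h1.unique ((hasDerivAt_id y).congr_of_eventuallyEq (treeFun_comp_treeInv hy))
  exact eq_inv_of_mul_eq_one_left h2

theorem evalSeries_treeSeries_le_one {x : ℝ} (hx : |x| < Real.exp (-1)) :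
    evalSeries treeSeries x ≤ 1 := by
  refine hasSum_le (fun n => ?_) (summableAt_treeSeries.mono (abs_nonneg x) hx.le).hasSum
    hasSum_scaledCoeff_treeSeries
  have h0 : (0 : ℝ) ≤ ((coeff n treeSeries : ℚ) : ℝ) := by
    have := isTreeLike_treeSeries.nonneg n
    rw [scaledCoeff] at this
    exact nonneg_of_mul_nonneg_left this (by positivity)
  rw [scaledCoeff]
  refine mul_le_mul_of_nonneg_left ((le_abs_self _).trans ?_) h0
  rw [abs_pow]
  gcongr

/-- The sum y of the series satisfies y e^(-y) = x; the bound y < 1 puts it on the branch inverted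
by `treeFun`. The value y = 1 would mean x = 1/e. -/
theorem isTreeContinuation_treeFun : IsTreeContinuation treeFun := by
  refine ⟨fun x hx => ?_, fun x hx => ?_⟩
  · obtain ⟨y, hy, rfl⟩ := exists_treeInv_eq hx
    exact analyticAt_treeFun hy
  · have h := (summableAt_treeSeries.mono (abs_nonneg x) hx.le).hasSum
    have he := evalSeries_treeSeries hx
    have hinv : treeInv (evalSeries treeSeries x) = x := by
      rw [treeInv]
      nth_rw 1 [he]
      rw [mul_assoc, ← Real.exp_add, add_neg_cancel, Real.exp_zero, mul_one]
    have hlt : evalSeries treeSeries x < 1 := by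
      refine lt_of_le_of_ne (evalSeries_treeSeries_le_one hx) fun h1 => ?_
      rw [h1, treeInv, one_mul] at hinv
      exact absurd (le_abs_self x) (not_le.2 (hinv ▸ hx))
    rwa [show treeFun x = evalSeries treeSeries x by
      rw [← treeFun_treeInv hlt, hinv]]

theorem treeInv_neg_greenSum : treeInv (-greenSum) = -1 := by
  rw [treeInv]
  nth_rw 1 [greenSum_eq]
  rw [neg_mul, ← Real.exp_add]
  simp

theorem treeFun_neg_one : treeFun (-1) = -greenSum := by
  rw [← treeInv_neg_greenSum, treeFun_treeInv (by linarith [greenSum_pos])]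

theorem deriv_treeFun_neg_one : deriv treeFun (-1) = greenSum / (1 + greenSum) := by
  have h := deriv_treeFun (y := -greenSum) (by linarith [greenSum_pos])
  rw [treeInv_neg_greenSum] at h
  have he : Real.exp (- -greenSum) = greenSum⁻¹ := by
    rw [Real.exp_neg, ← greenSum_eq]
  have h0 : greenSum ≠ 0 := greenSum_pos.ne'
  have h1 : 1 + greenSum ≠ 0 := by linarith [greenSum_pos]
  rw [h, he, sub_neg_eq_add]
  field_simp

/-- As s ↦ e^(-s) is decreasing, the sign of e^(-s) - s tells on which side of Ω the point s lies.
-/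
theorem lt_greenSum {a : ℝ} (h : a < Real.exp (-a)) : a < greenSum := by
  by_contra hc
  have : Real.exp (-a) ≤ Real.exp (-greenSum) := Real.exp_le_exp.2 (by linarith)
  linarith [greenSum_eq]

theorem greenSum_lt {b : ℝ} (h : Real.exp (-b) < b) : greenSum < b := by
  by_contra hc
  have : Real.exp (-greenSum) ≤ Real.exp (-b) := Real.exp_le_exp.2 (by linarith)
  linarith [greenSum_eq]

theorem lt_greenSum_decimal : 0.567143290409 < greenSum := by
  refine lt_greenSum ?_
  -- With 14 Taylor terms the error is below 10^(-14), well under the margin of about 10^(-12) left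
  -- by this decimal.
  have h := Real.exp_bound (x := -0.567143290409) (by norm_num [abs_le]) (n := 14) (by norm_num)
  have := (abs_le.1 h).1
  rw [abs_of_neg (by norm_num)] at this
  norm_num [Finset.sum_range_succ, Nat.factorial] at this ⊢
  linarith

theorem greenSum_lt_decimal : greenSum < 0.567143290410 := by
  refine greenSum_lt ?_
  have h := Real.exp_bound (x := -0.567143290410) (by norm_num [abs_le]) (n := 14) (by norm_num)
  have := (abs_le.1 h).2
  rw [abs_of_neg (by norm_num)] at this
  norm_num [Finset.sum_range_succ, Nat.factorial] at this ⊢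
  linarith

end Continuation

end TreeColoring

theorem theorem2 :
    -- the generating functions
    (TreeColoring.colorSeries .brown =
        TreeColoring.treeSeries + TreeColoring.treeSeriesNegTree
          - TreeColoring.treeSeriesNegTree ^ 2 ∧
      TreeColoring.colorSeries .red = TreeColoring.treeSeriesNegTree ^ 2 ∧
      TreeColoring.colorSeries .green = -TreeColoring.treeSeriesNegTree) ∧
    -- the first terms, for `n = 1, …, 10`
    ((List.range 10).map (fun i => TreeColoring.totalColored .brown (i + 1)) =
        [0, 0, 3, 4, 185, 1026, 30457, 362664, 10245825, 195060070] ∧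
      (List.range 10).map (fun i => TreeColoring.totalColored .red (i + 1)) =
        [0, 2, 0, 48, 120, 4560, 35700, 1048992, 15514128, 456726240] ∧
      (List.range 10).map (fun i => TreeColoring.totalColored .green (i + 1)) =
        [1, 0, 6, 12, 320, 2190, 51492, 685496, 17286768, 348213690]) ∧
    -- the closed formulas
    (∀ n : ℕ, 1 ≤ n →
      (TreeColoring.totalColored .brown n : ℚ) / (n : ℚ) ^ (n - 1) =
        1 + ∑ l ∈ Finset.Icc 1 n,
          (-(l : ℚ) / (n : ℚ)) ^ l * (2 / (l : ℚ) - 1) * (n.choose l : ℚ) ∧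
      (TreeColoring.totalColored .red n : ℚ) / (n : ℚ) ^ (n - 1) =
        -2 * ∑ l ∈ Finset.Icc 1 n,
          (-(l : ℚ) / (n : ℚ)) ^ l * (1 / (l : ℚ) - 1) * (n.choose l : ℚ) ∧
      (TreeColoring.totalColored .green n : ℚ) / (n : ℚ) ^ (n - 1) =
        -∑ l ∈ Finset.Icc 1 n, (-(l : ℚ) / (n : ℚ)) ^ l * (n.choose l : ℚ)) ∧
    -- the asymptotics, where `T` is the analytic continuation of the tree generating function
    (∃ T : ℝ → ℝ, TreeColoring.IsTreeContinuation T ∧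
      Filter.Tendsto
        (fun n : ℕ => (TreeColoring.totalColored .brown n : ℝ) / (n : ℝ) ^ (n - 1))
        Filter.atTop (nhds (1 + deriv T (-1) + 2 * T (-1))) ∧
      Filter.Tendsto
        (fun n : ℕ => (TreeColoring.totalColored .red n : ℝ) / (n : ℝ) ^ (n - 1))
        Filter.atTop (nhds (-2 * (deriv T (-1) + T (-1)))) ∧
      Filter.Tendsto
        (fun n : ℕ => (TreeColoring.totalColored .green n : ℝ) / (n : ℝ) ^ (n - 1))
        Filter.atTop (nhds (deriv T (-1))) ∧
      (0.2276096758 < 1 + deriv T (-1) + 2 * T (-1) ∧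
        1 + deriv T (-1) + 2 * T (-1) < 0.2276096759) ∧
      (0.4104940675 < -2 * (deriv T (-1) + T (-1)) ∧
        -2 * (deriv T (-1) + T (-1)) < 0.4104940676) ∧
      (0.3618962566 < deriv T (-1) ∧ deriv T (-1) < 0.3618962567)) := by
  open TreeColoring in
  have hp := greenSum_pos
  have hlo := lt_greenSum_decimal
  have hhi := greenSum_lt_decimal
  have h1 : 1 + greenSum ≠ 0 := by linarith
  refine ⟨⟨colorSeries_brown, colorSeries_red, colorSeries_green⟩,
    ⟨totalColored_brown_first, totalColored_red_first, totalColored_green_first⟩,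
    fun n hn => ⟨totalColored_brown_div (by omega), totalColored_red_div (by omega),
      totalColored_green_div (by omega)⟩,
    treeFun, isTreeContinuation_treeFun, ?_, ?_, ?_, ?_⟩
  · rw [deriv_treeFun_neg_one, treeFun_neg_one]
    -- With p = Ω/(1+Ω) one has Ωp = Ω - p, so the limit equals 1 + p - 2Ω; likewise the red one is
    -- 2(Ω - p).
    convert! tendsto_proportion_brown using 2
    field_simp
    ring
  · rw [deriv_treeFun_neg_one, treeFun_neg_one]
    convert! tendsto_proportion_red using 2
    field_simp
    ring
  · rw [deriv_treeFun_neg_one]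
    exact tendsto_proportion_green
  · rw [deriv_treeFun_neg_one, treeFun_neg_one]
    -- All three limits are affine in Ω and p = Ω/(1+Ω), and p increases with Ω; bracketing both
    -- numbers reduces the decimals to linear arithmetic.
    have hl : (0.567143290409 : ℝ) / (1 + 0.567143290409) < greenSum / (1 + greenSum) := by
      rw [div_lt_div_iff₀ (by norm_num) (by linarith)]
      linarith
    have hr : greenSum / (1 + greenSum) < (0.567143290410 : ℝ) / (1 + 0.567143290410) := by
      rw [div_lt_div_iff₀ (by linarith) (by norm_num)]
      linarith
    norm_num at hl hr hlo hhi ⊢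
    refine ⟨⟨?_, ?_⟩, ⟨?_, ?_⟩, ?_, ?_⟩ <;> linarith
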